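/- Let $\Gamma$ be a finite simple connected graph with vertex set $X$, path-length distance $\partial$ and diameter $D\ge 3$, and write $\Gamma_i(x)=\{y\in X:\partial(x,y)=i\}$. Assume $\Gamma$ is distance-regular, i.e. for $0\le h,i,j\le D$ the number $p^h_{ij}=|\Gamma_i(x)\cap\Gamma_j(y)|$ is the same for all $x,y\in X$ with $\partial(x,y)=h$. Put $c_i=p^i_{1,i-1}$ $(1\le i\le D)$, $a_i=p^i_{1,i}$ $(0\le i\le D)$, $b_i=p^i_{1,i+1}$ $(0\le i\le D-1)$. Assume that $\Gamma$ has classical parameters $(D,b,\alpha,\beta)$ with real $b<-1$ and real $\alpha,\beta$; that is, with ${j \brack 1}=1+b+\cdots+b^{j-1}$, $$c_i={i\brack 1}\Bigl(1+\alpha{i-1\brack 1}\Bigr)\ (1\le i\le D),\qquad b_i=\Bigl({D\brack 1}-{i\brack 1}\Bigr)\Bigl(\beta-\alpha{i\brack 1}\Bigr)\ (0\le i\le D-1).$$ Assume further that $a_1\ne 0$ and that $\Gamma$ is not a near polygon, where $\Gamma$ is called a near polygon if $a_i=a_1c_i$ for $1\le i\le D-1$ and there are no vertices $u,v,w,z$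 with $u,v,w$ mutually adjacent, $\partial(u,z)=2$ and $\partial(v,z)=\partial(w,z)=1$. Let $A_i$ $(0\le i\le D)$ be the $i$th distance matrix, with $(y,z)$-entry $1$ if $\partial(y,z)=i$ and $0$ otherwise, and let $A=A_1$. Fix $x\in X$ and let $E^*_i$ $(0\le i\le D)$ be the diagonal matrix with $(y,y)$-entry $1$ if $\partial(x,y)=i$ and $0$ otherwise. Let $T$ be the subalgebra of $\mathrm{Mat}_X(\mathbb C)$ generated by $A_0,\dots,A_D,E^*_0,\dots,E^*_D$ (the Terwilliger algebra with respect to $x$). A $T$-module is a subspace $W\subseteq\mathbb C^X$ with $BW\subseteq W$ for all $B\in T$; it is irreducible if it is nonzero and contains no $T$-modules other than $0$ and $W$. The endpoint of an irreducible $T$-module $W$ is $\min\{i: 0\le i\le D,\ E^*_iW\ne 0\}$ and its diameter is $|\{i:0\le i\le D,\ E^*_iW\neq 0\}|-1$. If $W$ has endpoint $1$, it has local eigenvalue $\eta$ if $E^*_1AE^*_1v=\eta v$ for all $v\in E^*_1W$. Let $W$ be an irreducible $T$-module with endpoint $1$ and local eigenvalue $-1$. Then: 1. for every nonzero $w\in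 E^*_1W$, the vectors $E^*_iA_{i-1}w$ $(1\le i\le D)$ form a basis of $W$; 2. $\dim E^*_iW=1$ for $1\le i\le D$; 3. $\dim W=D$; 4. the diameter of $W$ is $D-1$. -/

import Mathlib

noncomputable section

namespace DRG

section Graph

variable {X : Type*} [Fintype X]

/-- The set `Γ_i(x)` of vertices at distance `i` from `x`
(used for connected graphs only, where `G.dist` is the path-length distance). -/
def sphere (G : SimpleGraph X) (x : X) (i : ℕ) : Finset X :=
  Finset.univ.filter fun y => G.dist x y = i

/-- `G` is distance-regular: it is connected and, for `0 ≤ h, i, j ≤ D`, the number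
`|Γ_i(x) ∩ Γ_j(y)|` is the same for all `x, y` with `∂(x, y) = h`. -/
def IsDistanceRegular [DecidableEq X] (G : SimpleGraph X) : Prop :=
  G.Connected ∧ ∀ h i j : ℕ, h ≤ G.diam → i ≤ G.diam → j ≤ G.diam →
    ∀ x y x' y' : X, G.dist x y = h → G.dist x' y' = h →
      (sphere G x i ∩ sphere G y j).card = (sphere G x' i ∩ sphere G y' j).card

/-- The intersection number `p^h_{ij}`: the largest value of `|Γ_i(x) ∩ Γ_j(y)|` over all `x, y`
with `∂(x, y) = h`. For a distance-regular graph this is the common value, see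
`card_sphere_inter_sphere`. -/
def intersectionNumber [DecidableEq X] (G : SimpleGraph X) (h i j : ℕ) : ℕ :=
  (Finset.univ.filter fun q : X × X => G.dist q.1 q.2 = h).sup
    fun q => (sphere G q.1 i ∩ sphere G q.2 j).card

theorem card_sphere_inter_sphere [DecidableEq X] {G : SimpleGraph X} (hG : IsDistanceRegular G)
    {h i j : ℕ} (hh : h ≤ G.diam) (hi : i ≤ G.diam) (hj : j ≤ G.diam) {x y : X}
    (hxy : G.dist x y = h) :
    (sphere G x i ∩ sphere G y j).card = intersectionNumber G h i j := by
  apply le_antisymm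
  · exact Finset.le_sup (f := fun q : X × X => (sphere G q.1 i ∩ sphere G q.2 j).card)
      (b := (x, y)) (by simp [hxy])
  · refine Finset.sup_le fun q hq => ?_
    simp only [Finset.mem_filter, Finset.mem_univ, true_and] at hq
    exact (hG.2 h i j hh hi hj q.1 q.2 x y hq hxy).le

/-- `c_i = p^i_{1,i-1}` (for `i ≥ 1`). -/
def cNum [DecidableEq X] (G : SimpleGraph X) (i : ℕ) : ℕ := intersectionNumber G i 1 (i - 1)

/-- `a_i = p^i_{1,i}`. -/
def aNum [DecidableEq X] (G : SimpleGraph X) (i : ℕ) : ℕ := intersectionNumber G i 1 i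

/-- `b_i = p^i_{1,i+1}`. -/
def bNum [DecidableEq X] (G : SimpleGraph X) (i : ℕ) : ℕ := intersectionNumber G i 1 (i + 1)

/-- The bracket `[j 1] = 1 + b + ⋯ + b^{j-1}`. -/
def bracket (b : ℝ) (j : ℕ) : ℝ := ∑ l ∈ Finset.range j, b ^ l

/-- `G` has diameter `D` and classical parameters `(D, b, α, β)`. -/
def HasClassicalParameters [DecidableEq X] (G : SimpleGraph X) (D : ℕ) (b α β : ℝ) : Prop :=
  G.diam = D ∧
  (∀ i : ℕ, 1 ≤ i → i ≤ D → (cNum G i : ℝ) = bracket b i * (1 + α * bracket b (i - 1))) ∧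
  (∀ i : ℕ, i < D → (bNum G i : ℝ) = (bracket b D - bracket b i) * (β - α * bracket b i))

/-- The 4-tuple `uvwz` is a kite of length `i`. -/
def IsKite {X : Type*} (G : SimpleGraph X) (i : ℕ) (u v w z : X) : Prop :=
  G.Adj u v ∧ G.Adj v w ∧ G.Adj u w ∧
    G.dist u z = i ∧ G.dist v z = i - 1 ∧ G.dist w z = i - 1

/-- `G` is a near polygon: `a_i = a_1 c_i` for `1 ≤ i ≤ D - 1` and there is no `2`-kite. -/
def IsNearPolygon [DecidableEq X] (G : SimpleGraph X) : Prop :=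
  (∀ i : ℕ, 1 ≤ i → i < G.diam → aNum G i = aNum G 1 * cNum G i) ∧
    ¬ ∃ u v w z : X, IsKite G 2 u v w z

end Graph

section Terwilliger

variable {X : Type*} [Fintype X] [DecidableEq X]

/-- The `i`th distance matrix `A_i`; `A = A_1` is the adjacency matrix. -/
def distMatrix (G : SimpleGraph X) (i : ℕ) : Matrix X X ℂ :=
  Matrix.of fun y z => if G.dist y z = i then 1 else 0

/-- The `i`th dual idempotent `E*_i = E*_i(x)`. -/
def dualIdempotent (G : SimpleGraph X) (x : X) (i : ℕ) : Matrix X X ℂ :=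
  Matrix.diagonal fun y => if G.dist x y = i then 1 else 0

/-- The Bose–Mesner algebra `M`, as the span of `A_0, …, A_D`. -/
def boseMesner (G : SimpleGraph X) : Submodule ℂ (Matrix X X ℂ) :=
  Submodule.span ℂ (distMatrix G '' Set.Iic G.diam)

/-- The dual Bose–Mesner algebra `M* = M*(x)`, as the span of `E*_0, …, E*_D`. -/
def dualBoseMesner (G : SimpleGraph X) (x : X) : Submodule ℂ (Matrix X X ℂ) :=
  Submodule.span ℂ (dualIdempotent G x '' Set.Iic G.diam)

/-- The Terwilliger algebra `T = T(x)`: the subalgebra generated by `M` and `M*`. -/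
def terwilligerAlgebra (G : SimpleGraph X) (x : X) : Subalgebra ℂ (Matrix X X ℂ) :=
  Algebra.adjoin ℂ ((boseMesner G : Set (Matrix X X ℂ)) ∪ (dualBoseMesner G x : Set _))

/-- A `T`-module: a subspace `W` of the standard module `V = ℂ^X` with `B W ⊆ W` for `B ∈ T`. -/
def IsTModule (G : SimpleGraph X) (x : X) (W : Submodule ℂ (X → ℂ)) : Prop :=
  ∀ B ∈ terwilligerAlgebra G x, ∀ v ∈ W, B.mulVec v ∈ W

/-- An irreducible `T`-module: nonzero, containing no `T`-modules other than `0` and itself. -/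
def IsIrreducibleTModule (G : SimpleGraph X) (x : X) (W : Submodule ℂ (X → ℂ)) : Prop :=
  IsTModule G x W ∧ W ≠ ⊥ ∧ ∀ W' : Submodule ℂ (X → ℂ), IsTModule G x W' → W' ≤ W →
    W' = ⊥ ∨ W' = W

/-- The subspace `E*_i W`. -/
def dualComponent (G : SimpleGraph X) (x : X) (i : ℕ) (W : Submodule ℂ (X → ℂ)) :
    Submodule ℂ (X → ℂ) :=
  W.map (dualIdempotent G x i).mulVecLin

/-- The set `{i | 0 ≤ i ≤ D, E*_i W ≠ 0}` (nonempty when `W ≠ 0`). -/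
def dualSupport (G : SimpleGraph X) (x : X) (W : Submodule ℂ (X → ℂ)) : Set ℕ :=
  {i | i ≤ G.diam ∧ dualComponent G x i W ≠ ⊥}

/-- The endpoint of `W`: `min {i | 0 ≤ i ≤ D, E*_i W ≠ 0}`. -/
def endpoint (G : SimpleGraph X) (x : X) (W : Submodule ℂ (X → ℂ)) : ℕ :=
  sInf (dualSupport G x W)

/-- The diameter of `W`: `|{i | 0 ≤ i ≤ D, E*_i W ≠ 0}| - 1`. -/
def moduleDiameter (G : SimpleGraph X) (x : X) (W : Submodule ℂ (X → ℂ)) : ℕ :=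
  (dualSupport G x W).ncard - 1

/-- `η` is the local eigenvalue of `W` (`W` of endpoint `1`): `E*_1 W` is nonzero and consists of
eigenvectors of `E*_1 A E*_1` for `η`, together with `0`. -/
def HasLocalEigenvalue (G : SimpleGraph X) (x : X) (W : Submodule ℂ (X → ℂ)) (η : ℂ) : Prop :=
  dualComponent G x 1 W ≠ ⊥ ∧ ∀ v ∈ dualComponent G x 1 W,
    (dualIdempotent G x 1 * distMatrix G 1 * dualIdempotent G x 1).mulVec v = η • v

end Terwilliger

end DRG

end

noncomputable section

namespace DRG

/-! ### Intersection numbers of a distance-regular graph. -/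

section Counting

variable {X : Type*} [Fintype X] [DecidableEq X] {G : SimpleGraph X}

/-! The theorem rests on the absence of kites of every length when b < -1 and D ≥ 3 (`no_kite`). Let
w be a nonzero vector of E*_1 W. It sums to zero because the endpoint is 1, and it is a
(-1)-eigenvector of the local graph on Γ(x). For y in Γ_{i+1}(x), the set of t in Γ(x) at distance
i+2 from y is, for want of kites, a union of connected components of the regular local graph. Its
indicator is thus an a_1-eigenvector, orthogonal to w, so A_{i+2} w vanishes at y. Hence A_j w has
only two components, E*_{j+1}A_j w and -E*_j A_{j-1} w. The three-term recurrence for A A_j then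
makes A act tridiagonally on the vectors E*_i A_{i-1} w. Their span is a nonzero T-submodule of W,
hence W, and none of them vanishes because b_i > 0 for i < D.

Kites are excluded through the Q-polynomial structure. The sequence θ*_h = ξ + b^{-h} is an
eigenvector of the intersection-number recurrence and satisfies an Askey–Wilson relation with it
(`askeyWilson`), hence a tridiagonal relation. A sum-of-squares argument
(`sum_mul_diagonal_mul_eq_zero`) lifts this to A and the diagonal matrix S of entries θ*_{∂(x,t)}.
As b is not a root of unity, A S A_j - A_j S A is then a combination of commutators [A_n, S]: this
is the balanced set condition (`balanced_set`). Comparing two instances of it shows that one vertex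
count is b^j times another (`card_eq_pow_mul_card`). For odd j the sign of b^j forbids kites of
length j+2; the even lengths follow from the odd ones, by extending a kite of length 2 and by the
bound b^j < c_{j+1} otherwise. -/

theorem IsDistanceRegular.dist_le (hG : IsDistanceRegular G) (y z : X) :
    G.dist y z ≤ G.diam := by
  have : Nonempty X := ⟨y⟩
  exact SimpleGraph.dist_le_diam (SimpleGraph.connected_iff_ediam_ne_top.1 hG.1)

/-- Every vertex adjacent to `y` lies at distance `h - 1`, `h` or `h + 1` from a vertex at
distance `h` from `y`. -/
theorem IsDistanceRegular.dist_cases (hG : IsDistanceRegular G) {y t : X} (h : G.dist y t = 1)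
    (z : X) : G.dist t z + 1 = G.dist y z ∨ G.dist t z = G.dist y z ∨
      G.dist t z = G.dist y z + 1 := by
  have h1 := hG.1.dist_triangle (u := y) (v := t) (w := z)
  have h2 := hG.1.dist_triangle (u := t) (v := y) (w := z)
  rw [SimpleGraph.dist_comm (u := t) (v := y)] at h2
  omega

theorem IsDistanceRegular.card_filter (hG : IsDistanceRegular G) (hD : 1 ≤ G.diam) {j : ℕ}
    (hj : j ≤ G.diam) (y z : X) :
    (Finset.univ.filter fun t => G.dist y t = 1 ∧ G.dist t z = j).card =
      intersectionNumber G (G.dist y z) 1 j := by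
  rw [← card_sphere_inter_sphere hG (hG.dist_le y z) hD hj rfl]
  congr 1
  ext t
  simp [sphere, SimpleGraph.dist_comm (u := z)]

theorem IsDistanceRegular.card_cNum (hG : IsDistanceRegular G) (hD : 1 ≤ G.diam) (y z : X) :
    (Finset.univ.filter fun t => G.dist y t = 1 ∧ G.dist t z + 1 = G.dist y z).card =
      cNum G (G.dist y z) := by
  rw [cNum, ← hG.card_filter hD (by have := hG.dist_le y z; omega)]
  congr 1
  ext t
  simp only [Finset.mem_filter, Finset.mem_univ, true_and, and_congr_right_iff]
  intro ht
  constructor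
  · omega
  · intro h
    -- With truncated subtraction `cNum G 0` is p^0_{1,0}; here y = z, and both sets are empty.
    rcases Nat.eq_zero_or_pos (G.dist y z) with h0 | h0
    · have h1 : y = z := (hG.1.dist_eq_zero_iff).1 h0
      subst h1
      rw [SimpleGraph.dist_comm] at h
      omega
    · omega

theorem IsDistanceRegular.card_aNum (hG : IsDistanceRegular G) (hD : 1 ≤ G.diam) (y z : X) :
    (Finset.univ.filter fun t => G.dist y t = 1 ∧ G.dist t z = G.dist y z).card =
      aNum G (G.dist y z) := by
  rw [aNum, ← hG.card_filter hD (hG.dist_le y z)]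

theorem IsDistanceRegular.bNum_diam (hG : IsDistanceRegular G) : bNum G G.diam = 0 := by
  refine Nat.le_zero.1 (Finset.sup_le fun q _ => ?_)
  rw [Nat.le_zero, Finset.card_eq_zero, Finset.eq_empty_iff_forall_notMem]
  intro t ht
  simp only [sphere, Finset.mem_inter, Finset.mem_filter, Finset.mem_univ, true_and] at ht
  have := hG.dist_le q.2 t
  omega

theorem IsDistanceRegular.card_bNum (hG : IsDistanceRegular G) (hD : 1 ≤ G.diam) (y z : X) :
    (Finset.univ.filter fun t => G.dist y t = 1 ∧ G.dist t z = G.dist y z + 1).card =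
      bNum G (G.dist y z) := by
  rcases (hG.dist_le y z).lt_or_eq with h | h
  · rw [bNum, ← hG.card_filter hD h]
  · rw [h, hG.bNum_diam, Finset.card_eq_zero, Finset.eq_empty_iff_forall_notMem]
    intro t ht
    simp only [Finset.mem_filter, Finset.mem_univ, true_and] at ht
    have := hG.dist_le t z
    omega

/-- Neighbours of y are sorted by their distance to z. Sequences are indexed by ℤ so that no
boundary cases are needed: the stray values g(-1) and g(D+1) carry the weights c_0 = 0 and b_D = 0.
-/
theorem IsDistanceRegular.sum_adj (hG : IsDistanceRegular G) (hD : 1 ≤ G.diam) {R : Type*}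
    [CommRing R] (g : ℤ → R) (y z : X) :
    ∑ t, (if G.dist y t = 1 then g (G.dist t z) else 0) =
      cNum G (G.dist y z) * g (G.dist y z - 1) + aNum G (G.dist y z) * g (G.dist y z) +
        bNum G (G.dist y z) * g (G.dist y z + 1) := by
  rw [← hG.card_cNum hD, ← hG.card_aNum hD, ← hG.card_bNum hD]
  simp only [Finset.card_filter, Nat.cast_sum, Finset.sum_mul, ← Finset.sum_add_distrib]
  refine Finset.sum_congr rfl fun t _ => ?_
  by_cases ht : G.dist y t = 1
  · rcases hG.dist_cases ht z with h | h | h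
    · have h1 : ((G.dist y z : ℕ) : ℤ) - 1 = G.dist t z := by omega
      rw [h1]
      simp [ht, h, show G.dist t z ≠ G.dist y z by omega,
        show G.dist t z ≠ G.dist y z + 1 by omega]
    · simp [ht, h]
    · simp [ht, h, add_assoc]
  · simp [ht]

theorem IsDistanceRegular.cNum_zero (hG : IsDistanceRegular G) (hD : 1 ≤ G.diam) :
    cNum G 0 = 0 := by
  obtain ⟨y⟩ := hG.1.nonempty
  have := hG.card_cNum hD y y
  simpa using this.symm

theorem IsDistanceRegular.exists_dist_eq (hG : IsDistanceRegular G) {h : ℕ} (hh : h ≤ G.diam) :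
    ∃ y z, G.dist y z = h := by
  have := hG.1.nonempty
  obtain ⟨u, v, huv⟩ := G.exists_dist_eq_diam
  obtain ⟨p, hp, hl⟩ := hG.1.exists_path_of_dist u v
  have hle : h ≤ p.length := by omega
  refine ⟨u, p.getVert h, le_antisymm ?_ ?_⟩
  · have := SimpleGraph.dist_le (p.take h)
    rwa [SimpleGraph.Walk.take_length, min_eq_left hle] at this
  · have h1 := SimpleGraph.dist_le (p.drop h)
    have h2 := hG.1.dist_triangle (u := u) (v := p.getVert h) (w := v)
    rw [SimpleGraph.Walk.drop_length] at h1
    omega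

theorem IsDistanceRegular.add_num (hG : IsDistanceRegular G) (hD : 1 ≤ G.diam) {h : ℕ}
    (hh : h ≤ G.diam) : (cNum G h + aNum G h + bNum G h : ℤ) = bNum G 0 := by
  obtain ⟨y, z, rfl⟩ := hG.exists_dist_eq hh
  have h1 := hG.sum_adj hD (fun _ => (1 : ℤ)) y z
  -- Evaluating at z = y identifies the valency with b_0.
  have h2 := hG.sum_adj hD (fun i => if i = 1 then (1 : ℤ) else 0) y y
  simp only [SimpleGraph.dist_self, SimpleGraph.dist_comm (v := y)] at h2
  rw [hG.cNum_zero hD] at h2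
  have h3 : ∀ t, (if G.dist y t = 1 then if (G.dist y t : ℤ) = 1 then (1 : ℤ) else 0 else 0) =
      if G.dist y t = 1 then 1 else 0 := fun t => by
    split_ifs <;> simp_all
  simp only [h3] at h2
  rw [h2] at h1
  simpa using h1.symm

theorem IsDistanceRegular.exists_prev (hG : IsDistanceRegular G) {y z : X} {h : ℕ}
    (hyz : G.dist y z = h + 1) : ∃ t, G.dist y t = 1 ∧ G.dist t z = h := by
  obtain ⟨p, hp⟩ := hG.1.exists_walk_length_eq_dist y z
  have h1 := SimpleGraph.dist_le (p.take 1)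
  have h2 := SimpleGraph.dist_le (p.drop 1)
  have h3 := hG.1.dist_triangle (u := y) (v := p.getVert 1) (w := z)
  rw [SimpleGraph.Walk.take_length] at h1
  rw [SimpleGraph.Walk.drop_length] at h2
  exact ⟨p.getVert 1, by omega, by omega⟩

theorem IsDistanceRegular.cNum_pos (hG : IsDistanceRegular G) {h : ℕ} (h0 : 1 ≤ h)
    (hh : h ≤ G.diam) : 0 < cNum G h := by
  obtain ⟨y, z, hy⟩ := hG.exists_dist_eq hh
  obtain ⟨t, ht1, ht2⟩ := hG.exists_prev (hy.trans (Nat.sub_add_cancel h0).symm)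
  rw [← hy, ← hG.card_cNum (h0.trans hh), Finset.card_pos]
  exact ⟨t, by simp only [Finset.mem_filter, Finset.mem_univ, true_and]; omega⟩

theorem IsDistanceRegular.bNum_pos (hG : IsDistanceRegular G) {h : ℕ} (hh : h < G.diam) :
    0 < bNum G h := by
  obtain ⟨y, z, hy⟩ := hG.exists_dist_eq (Nat.succ_le_of_lt hh)
  obtain ⟨t, ht1, ht2⟩ := hG.exists_prev hy
  rw [← ht2, ← hG.card_bNum (by omega), Finset.card_pos]
  exact ⟨y, by rw [SimpleGraph.dist_comm] at ht1; simp [ht1, ht2, hy]⟩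

theorem IsDistanceRegular.exists_next (hG : IsDistanceRegular G) {y z : X}
    (h : G.dist y z < G.diam) : ∃ t, G.dist y t = 1 ∧ G.dist t z = G.dist y z + 1 := by
  have := hG.bNum_pos h
  rw [← hG.card_bNum (by omega), Finset.card_pos] at this
  obtain ⟨t, ht⟩ := this
  exact ⟨t, by simpa using ht⟩

end Counting

/-! ### Askey–Wilson and tridiagonal relations for sequences. -/

section Recurrence

/-- The three-term operator `g ↦ (h ↦ c_h g_{h-1} + a_h g_h + b_h g_{h+1})` on sequences. -/
def threeTerm (c a b : ℤ → ℝ) : Module.End ℝ (ℤ → ℝ) where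
  toFun g h := c h * g (h - 1) + a h * g h + b h * g (h + 1)
  map_add' g g' := by ext h; simp only [Pi.add_apply]; ring
  map_smul' r g := by ext h; simp only [Pi.smul_apply, smul_eq_mul, RingHom.id_apply]; ring

theorem threeTerm_apply (c a b g : ℤ → ℝ) (h : ℤ) :
    threeTerm c a b g h = c h * g (h - 1) + a h * g h + b h * g (h + 1) := rfl

/-- `c_h` of classical parameters, as a function of an integer `h`. -/
def classicalC (b α : ℝ) (h : ℤ) : ℝ :=
  (b ^ h - 1) / (b - 1) * (1 + α * ((b ^ h / b - 1) / (b - 1)))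

/-- `b_h` of classical parameters, as a function of an integer `h`; here `Q = b ^ D`. -/
def classicalB (b α β Q : ℝ) (h : ℤ) : ℝ :=
  (Q - b ^ h) / (b - 1) * (β - α * ((b ^ h - 1) / (b - 1)))

/-- The constant term of the eigenvalue `θ_i`, as a Laurent polynomial in `b ^ i`. -/
def eigShift (b α β Q : ℝ) : ℝ :=
  (1 - β) / (b - 1) - α * (Q + 1) / (b - 1) ^ 2

/-- The coefficient of `b ^ i` in `θ_i`. -/
def eigPos (b α : ℝ) : ℝ := (α / (b - 1) - 1) / (b - 1)

/-- The coefficient of `b ^ (-i)` in `θ_i`. -/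
def eigNeg (b α β Q : ℝ) : ℝ := Q * (β + α / (b - 1)) / (b - 1)

/-- The linear coefficient of `a_h - eigShift` in `b ^ h`. -/
def aLin (b α β Q : ℝ) : ℝ := (β - 1) / (b - 1) + α * (2 + 1 / b + Q) / (b - 1) ^ 2

/-- The value `a_h - eigShift`. -/
def shiftedA (b α β Q : ℝ) (h : ℤ) : ℝ :=
  aLin b α β Q * b ^ h - α * (1 + 1 / b) / (b - 1) ^ 2 * (b ^ h) ^ 2

/-- This is a_h = b_0 - b_h - c_h; subtracting `eigShift` removes exactly the constant term of a_h
as a polynomial in b^h. -/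
theorem shiftedA_eq {b : ℝ} (hb0 : b ≠ 0) (hb1 : b - 1 ≠ 0) (α β Q : ℝ) (h : ℤ) :
    shiftedA b α β Q h = classicalB b α β Q 0 - classicalB b α β Q h - classicalC b α h -
      eigShift b α β Q := by
  simp only [shiftedA, classicalB, classicalC, eigShift, aLin, zpow_zero]
  generalize b ^ h = Y
  field_simp
  ring

/-- The constant `ρ` of the tridiagonal relation. -/
def tdRho (b α β Q : ℝ) : ℝ := -(eigPos b α * eigNeg b α β Q * (b - 1 / b) ^ 2)

/-- The operator of `A - eigShift` on sequences. -/
def shiftedOp (b α β Q : ℝ) : Module.End ℝ (ℤ → ℝ) :=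
  threeTerm (classicalC b α) (shiftedA b α β Q) (classicalB b α β Q)

/-- Pointwise multiplication by the sequence `f`. -/
abbrev mulOp (f : ℤ → ℝ) : Module.End ℝ (ℤ → ℝ) := LinearMap.mulLeft ℝ f

/-- The dual eigenvalue sequence `ξ + b ^ (-h)`. -/
def dualSeq (b ξ : ℝ) (h : ℤ) : ℝ := ξ + (b ^ h)⁻¹

/-- The linear coefficient on the right of the Askey–Wilson relation. -/
def awLin (b α β Q : ℝ) : ℝ := -(aLin b α β Q * (b - 1) ^ 2 / b)

/-- The constant coefficient on the right of the Askey–Wilson relation. -/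
def awConst (b α β Q : ℝ) : ℝ :=
  classicalB b α β Q 0 * (2 - (b + 1 / b) / b) + shiftedA b α β Q 0 ^ 2 * (2 - (b + 1 / b)) -
    tdRho b α β Q - awLin b α β Q * shiftedA b α β Q 0

/-- Compare the coefficients of g(h-2), …, g(h+2). The outer two vanish because b^{-h} solves
y_{h+1} - (b + 1/b) y_h + y_{h-1} = 0; the others are rational identities in Y = b^h. -/
theorem askeyWilson {b : ℝ} (hb0 : b ≠ 0) (hb1 : b - 1 ≠ 0) (α β Q : ℝ) (g : ℤ → ℝ) (h : ℤ) :
    shiftedOp b α β Q (shiftedOp b α β Q (dualSeq b 0 * g)) h -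
      (b + 1 / b) * shiftedOp b α β Q (dualSeq b 0 * shiftedOp b α β Q g) h +
      dualSeq b 0 h * shiftedOp b α β Q (shiftedOp b α β Q g) h -
      tdRho b α β Q * (dualSeq b 0 h * g h) =
    awLin b α β Q * shiftedOp b α β Q g h + awConst b α β Q * g h := by
  have hY : b ^ h ≠ 0 := zpow_ne_zero _ hb0
  have e1 : h - 1 + 1 = h := by ring
  have e2 : h + 1 - 1 = h := by ring
  have z1 : ∀ n : ℤ, b ^ (n + 1) = b ^ n * b := fun n => zpow_add_one₀ hb0 n
  have z2 : ∀ n : ℤ, b ^ (n - 1) = b ^ n / b := fun n => by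
    rw [zpow_sub_one₀ hb0, div_eq_mul_inv]
  simp only [shiftedOp, threeTerm_apply, Pi.mul_apply, dualSeq, zero_add, e1, e2, z1, z2]
  have k2 : classicalC b α h * classicalC b α (h - 1) *
      ((b ^ h / b / b)⁻¹ - (b + 1 / b) * (b ^ h / b)⁻¹ + (b ^ h)⁻¹) = 0 := by
    have : (b ^ h / b / b)⁻¹ - (b + 1 / b) * (b ^ h / b)⁻¹ + (b ^ h)⁻¹ = 0 := by
      field_simp; ring
    rw [this, mul_zero]
  have k3 : classicalB b α β Q h * classicalB b α β Q (h + 1) *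
      ((b ^ h * b * b)⁻¹ - (b + 1 / b) * (b ^ h * b)⁻¹ + (b ^ h)⁻¹) = 0 := by
    have : (b ^ h * b * b)⁻¹ - (b + 1 / b) * (b ^ h * b)⁻¹ + (b ^ h)⁻¹ = 0 := by
      field_simp; ring
    rw [this, mul_zero]
  have k4 : shiftedA b α β Q (h + 1) * ((b ^ h * b)⁻¹ * (1 - (b + 1 / b)) + (b ^ h)⁻¹) +
      shiftedA b α β Q h * ((b ^ h * b)⁻¹ + (1 - (b + 1 / b)) * (b ^ h)⁻¹) = awLin b α β Q := by
    simp only [shiftedA, awLin, z1]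
    generalize aLin b α β Q = u
    generalize b ^ h = Y at *
    field_simp
    ring
  have k5 : shiftedA b α β Q (h - 1) * ((b ^ h / b)⁻¹ * (1 - (b + 1 / b)) + (b ^ h)⁻¹) +
      shiftedA b α β Q h * ((b ^ h / b)⁻¹ + (1 - (b + 1 / b)) * (b ^ h)⁻¹) = awLin b α β Q := by
    simp only [shiftedA, awLin, z2]
    generalize aLin b α β Q = u
    generalize b ^ h = Y at *
    field_simp
    ring
  -- `awConst` is defined by the case h = 0 of this identity, where c_0 = 0 and c_1 = 1.
  have k6 : classicalC b α h * classicalB b α β Q (h - 1) *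
        (2 * (b ^ h)⁻¹ - (b + 1 / b) * (b ^ h / b)⁻¹) +
      classicalB b α β Q h * classicalC b α (h + 1) *
        (2 * (b ^ h)⁻¹ - (b + 1 / b) * (b ^ h * b)⁻¹) +
      shiftedA b α β Q h ^ 2 * (b ^ h)⁻¹ * (2 - (b + 1 / b)) - tdRho b α β Q * (b ^ h)⁻¹ =
      awLin b α β Q * shiftedA b α β Q h + awConst b α β Q := by
    simp only [shiftedA, awLin, awConst, classicalB, classicalC, tdRho, eigPos, eigNeg, aLin,
      z1, z2, zpow_zero]
    generalize b ^ h = Y at *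
    field_simp
    ring
  linear_combination g (h - 1 - 1) * k2 + g (h + 1 + 1) * k3 +
    classicalB b α β Q h * g (h + 1) * k4 + classicalC b α h * g (h - 1) * k5 + g h * k6

theorem askeyWilson_op {b : ℝ} (hb0 : b ≠ 0) (hb1 : b - 1 ≠ 0) (α β Q ξ : ℝ) :
    shiftedOp b α β Q ^ 2 * mulOp (dualSeq b ξ) -
      (b + 1 / b) • (shiftedOp b α β Q * mulOp (dualSeq b ξ) * shiftedOp b α β Q) +
      mulOp (dualSeq b ξ) * shiftedOp b α β Q ^ 2 - tdRho b α β Q • mulOp (dualSeq b ξ) =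
    (ξ * (2 - (b + 1 / b))) • shiftedOp b α β Q ^ 2 + awLin b α β Q • shiftedOp b α β Q +
      (awConst b α β Q - ξ * tdRho b α β Q) • 1 := by
  have hsplit : ∀ g : ℤ → ℝ, dualSeq b ξ * g = ξ • g + dualSeq b 0 * g := fun g => by
    ext h; simp only [dualSeq, Pi.mul_apply, Pi.add_apply, Pi.smul_apply, smul_eq_mul]; ring
  refine LinearMap.ext fun g => funext fun h => ?_
  have key := askeyWilson hb0 hb1 α β Q g h
  simp only [pow_two, LinearMap.add_apply, LinearMap.sub_apply, LinearMap.smul_apply,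
    Module.End.mul_apply, LinearMap.mulLeft_apply, Module.End.one_apply, hsplit, map_add, map_smul,
    Pi.add_apply, Pi.sub_apply, Pi.smul_apply, smul_eq_mul, Pi.mul_apply] at key ⊢
  linear_combination key

/-- The tridiagonal relation for sequences. -/
theorem tridiagonal_op {b : ℝ} (hb0 : b ≠ 0) (hb1 : b - 1 ≠ 0) (α β Q ξ : ℝ) :
    shiftedOp b α β Q ^ 3 * mulOp (dualSeq b ξ) - mulOp (dualSeq b ξ) * shiftedOp b α β Q ^ 3 -
      (b + 1 / b + 1) • (shiftedOp b α β Q ^ 2 * mulOp (dualSeq b ξ) * shiftedOp b α β Q -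
        shiftedOp b α β Q * mulOp (dualSeq b ξ) * shiftedOp b α β Q ^ 2) -
      tdRho b α β Q • (shiftedOp b α β Q * mulOp (dualSeq b ξ) -
        mulOp (dualSeq b ξ) * shiftedOp b α β Q) = 0 := by
  have key := askeyWilson_op hb0 hb1 α β Q ξ
  generalize shiftedOp b α β Q = L at *
  generalize mulOp (dualSeq b ξ) = F at *
  -- Take the commutator with L: the right-hand side is a polynomial in L and drops out.
  have h1 := congrArg (fun P => L * P - P * L) key
  simp only [mul_add, mul_sub, add_mul, sub_mul, mul_smul_comm, smul_mul_assoc, mul_one,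
    one_mul] at h1
  have e : L * L ^ 2 = L ^ 2 * L := by noncomm_ring
  rw [e] at h1
  rw [← sub_eq_zero] at h1
  rw [← h1]
  simp only [pow_succ, pow_zero, one_mul, mul_assoc, smul_sub, add_smul, one_smul]
  module

/-- Applied to b^{-h}, the operator minus its eigenvalue gives a constant independent of h, and
likewise on constant sequences. One scalar equation for ξ therefore settles every h. -/
theorem shiftedOp_dualSeq {b : ℝ} (hb0 : b ≠ 0) (hb1 : b - 1 ≠ 0) (α β Q ξ : ℝ)
    (hξ : ξ * (classicalB b α β Q 0 - eigShift b α β Q - (eigPos b α * b + eigNeg b α β Q / b)) +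
      (shiftedA b α β Q 0 + classicalB b α β Q 0 / b -
        (eigPos b α * b + eigNeg b α β Q / b)) = 0) (h : ℤ) :
    shiftedOp b α β Q (dualSeq b ξ) h =
      (eigPos b α * b + eigNeg b α β Q / b) * dualSeq b ξ h := by
  have hY : b ^ h ≠ 0 := zpow_ne_zero _ hb0
  have z1 : ∀ n : ℤ, b ^ (n + 1) = b ^ n * b := fun n => zpow_add_one₀ hb0 n
  have z2 : ∀ n : ℤ, b ^ (n - 1) = b ^ n / b := fun n => by
    rw [zpow_sub_one₀ hb0, div_eq_mul_inv]
  have ha := shiftedA_eq hb0 hb1 α β Q h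
  have k1 : classicalC b α h * (b ^ h / b)⁻¹ + shiftedA b α β Q h * (b ^ h)⁻¹ +
      classicalB b α β Q h * (b ^ h * b)⁻¹ -
        (eigPos b α * b + eigNeg b α β Q / b) * (b ^ h)⁻¹ =
      shiftedA b α β Q 0 + classicalB b α β Q 0 / b -
        (eigPos b α * b + eigNeg b α β Q / b) := by
    simp only [shiftedA, classicalB, classicalC, eigPos, eigNeg, aLin, zpow_zero]
    generalize b ^ h = Y at *
    field_simp
    ring
  simp only [shiftedOp, threeTerm_apply, dualSeq, z1, z2]
  linear_combination hξ + k1 + ξ * ha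

end Recurrence

/-! ### From the tridiagonal relation to commutators. -/

section Antisymmetric

/-- The recurrence says that δ_{i+2} - (q + 1/q) δ_{i+1} + δ_i does not depend on i. Antisymmetry
sends this constant to its negative, so it is 0 and δ_i is proportional to q^i - q^{-i}. Since δ_n =
0 and q is not a root of unity, δ = 0. -/
theorem eq_zero_of_antisymm_recurrence {V : Type*} [AddCommGroup V] [Module ℝ V] {q : ℝ}
    (hq0 : q ≠ 0) (hq : ∀ n : ℕ, n ≠ 0 → q ^ n ≠ 1) (n : ℕ) (δ : ℕ → V) (h0 : δ 0 = 0)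
    (hanti : ∀ i ≤ n, δ (n - i) = -δ i)
    (hrec : ∀ i, i + 3 ≤ n →
      δ (i + 3) - δ i - (q + 1 / q + 1) • (δ (i + 2) - δ (i + 1)) = 0) :
    ∀ i ≤ n, δ i = 0 := by
  have hn : δ n = 0 := by simpa [h0] using hanti 0 (Nat.zero_le _)
  rcases Nat.lt_or_ge n 2 with h2 | h2
  · intro i hi
    rcases Nat.eq_zero_or_pos i with rfl | hi0
    · exact h0
    · rwa [show i = n by omega]
  have hconst : ∀ i, i + 2 ≤ n →
      δ (i + 2) - (q + 1 / q) • δ (i + 1) + δ i = δ 2 - (q + 1 / q) • δ 1 + δ 0 := by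
    intro i
    induction i with
    | zero => intro _; rfl
    | succ i ih =>
      intro hi
      rw [← ih (by omega), ← sub_eq_zero, ← hrec i (by omega)]
      module
  have hz : δ 2 - (q + 1 / q) • δ 1 + δ 0 = 0 := by
    have h3 := hconst (n - 2) (by omega)
    rw [show n - 2 + 2 = n - 0 by omega, show n - 2 + 1 = n - 1 by omega, hanti 0 (by omega),
      hanti 1 (by omega), hanti 2 (by omega)] at h3
    have h4 : (2 : ℝ) • (δ 2 - (q + 1 / q) • δ 1 + δ 0) = 0 := by
      rw [two_smul]
      nth_rewrite 1 [← h3]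
      module
    exact (smul_eq_zero.1 h4).resolve_left two_ne_zero
  have hstep : ∀ i, i + 2 ≤ n → δ (i + 2) = (q + 1 / q) • δ (i + 1) - δ i := by
    intro i hi
    have h3 := hconst i hi
    rw [hz] at h3
    rw [← sub_eq_zero, ← h3]
    abel
  have hsol : ∀ i, (i ≤ n → (q - q⁻¹) • δ i = (q ^ i - (q ^ i)⁻¹) • δ 1) ∧
      (i + 1 ≤ n → (q - q⁻¹) • δ (i + 1) = (q ^ (i + 1) - (q ^ (i + 1))⁻¹) • δ 1) := by
    intro i
    induction i with
    | zero => simp [h0]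
    | succ i ih =>
      refine ⟨ih.2, fun hi => ?_⟩
      rw [hstep i (by omega), smul_sub, smul_comm, ih.2 (by omega), ih.1 (by omega), smul_smul,
        ← sub_smul]
      congr 1
      have : q ^ i ≠ 0 := pow_ne_zero _ hq0
      simp only [pow_succ]
      field_simp
      ring
  have hne : ∀ i, i ≠ 0 → q ^ i - (q ^ i)⁻¹ ≠ 0 := by
    intro i hi h
    have h1 : q ^ i ≠ 0 := pow_ne_zero _ hq0
    have h3 : q ^ (i * 2) = 1 := by
      rw [pow_mul, pow_two]
      field_simp at h
      linear_combination h
    exact hq (i * 2) (by omega) h3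
  have h1 : δ 1 = 0 := by
    have h3 := (hsol n).1 le_rfl
    rw [hn, smul_zero] at h3
    exact (smul_eq_zero.1 h3.symm).resolve_left (hne n (by omega))
  intro i hi
  have h3 := (hsol i).1 hi
  rw [h1, smul_zero] at h3
  refine (smul_eq_zero.1 h3).resolve_left ?_
  simpa using hne 1 one_ne_zero

variable {R : Type*} [Ring R] [Algebra ℝ R]

/-- If `S` satisfies the tridiagonal relation with respect to `A`, then every
`A ^ i * S * A ^ k - A ^ k * S * A ^ i` is a combination of the commutators `[A ^ n, S]`. -/
theorem pow_mul_pow_sub_mem {q ρ : ℝ} (hq0 : q ≠ 0) (hq : ∀ n : ℕ, n ≠ 0 → q ^ n ≠ 1) {A S : R}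
    (htd : A ^ 3 * S - S * A ^ 3 - (q + 1 / q + 1) • (A ^ 2 * S * A - A * S * A ^ 2) -
      ρ • (A * S - S * A) = 0) (M : Submodule ℝ R) (hM : ∀ n, A ^ n * S - S * A ^ n ∈ M) :
    ∀ n i k : ℕ, i + k = n → A ^ i * S * A ^ k - A ^ k * S * A ^ i ∈ M := by
  intro n
  induction n using Nat.strong_induction_on with
  | _ n ih =>
  set d : ℕ → ℕ → R := fun i k => A ^ i * S * A ^ k - A ^ k * S * A ^ i with hd
  have hanti : ∀ i k, d k i = -d i k := fun i k => by simp only [hd]; abel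
  have htd' : ∀ i k, d (i + 3) k - d i (k + 3) -
      (q + 1 / q + 1) • (d (i + 2) (k + 1) - d (i + 1) (k + 2)) -
      ρ • (d (i + 1) k - d i (k + 1)) = 0 := by
    intro i k
    -- Sandwich the relation between A^i and A^k, in both orders, and add.
    have h1 := congrArg (fun P => A ^ i * P * A ^ k + A ^ k * P * A ^ i) htd
    simp only [mul_zero, zero_mul, add_zero, mul_sub, sub_mul, mul_smul_comm,
      smul_mul_assoc] at h1
    rw [← h1]
    simp only [hd, pow_add A i, pow_add A k, pow_one]
    have e1 : ∀ m : ℕ, A ^ m * A = A * A ^ m := fun m => (pow_succ A m).symm.trans (pow_succ' A m)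
    have e2 : ∀ m : ℕ, A ^ m * A ^ 2 = A ^ 2 * A ^ m := fun m => by
      rw [← pow_add, ← pow_add, add_comm]
    have e3 : ∀ m : ℕ, A ^ m * A ^ 3 = A ^ 3 * A ^ m := fun m => by
      rw [← pow_add, ← pow_add, add_comm]
    have e4 : ∀ P : R, ∀ m : ℕ, P * A ^ 2 * A ^ m = P * A ^ m * A ^ 2 := fun P m => by
      rw [mul_assoc, ← e2, mul_assoc]
    have e5 : ∀ P : R, ∀ m : ℕ, P * A ^ 3 * A ^ m = P * A ^ m * A ^ 3 := fun P m => by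
      rw [mul_assoc, ← e3, mul_assoc]
    have e6 : ∀ P : R, ∀ m : ℕ, P * A * A ^ m = P * A ^ m * A := fun P m => by
      rw [mul_assoc, ← e1, mul_assoc]
    simp only [← mul_assoc, e4, e5, e6]
    module
  have hlow : ∀ i k, i + k < n → M.mkQ (d i k) = 0 := fun i k h =>
    (Submodule.Quotient.mk_eq_zero M).2 (ih _ h i k rfl)
  -- Modulo M the ρ-terms, of total degree n - 2, vanish by induction, leaving the pure recurrence
  -- along i + k = n.
  have key := eq_zero_of_antisymm_recurrence (V := R ⧸ M) hq0 hq n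
    (fun i => M.mkQ (d i (n - i)))
    ((Submodule.Quotient.mk_eq_zero M).2 (by
      have := M.neg_mem (hM n)
      simpa [hd] using this))
    (fun i hi => by
      show M.mkQ _ = -M.mkQ _
      rw [← map_neg, ← hanti, Nat.sub_sub_self hi])
    (fun i hi => by
      have h1 := congrArg M.mkQ (htd' i (n - (i + 3)))
      simp only [map_sub, map_smul, map_zero] at h1
      rw [hlow (i + 1) (n - (i + 3)) (by omega), hlow i (n - (i + 3) + 1) (by omega), sub_zero, smul_zero,
        sub_zero] at h1
      rw [show n - (i + 3) + 3 = n - i by omega, show n - (i + 3) + 1 = n - (i + 2) by omega,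
        show n - (i + 3) + 2 = n - (i + 1) by omega] at h1
      exact h1)
  intro i k hik
  have h1 := key i (by omega)
  rw [show n - i = k by omega] at h1
  exact (Submodule.Quotient.mk_eq_zero M).1 h1

theorem mul_mul_sub_mem_of_mem_adjoin {A S : R} (M : Submodule ℝ R)
    (hM : ∀ i k : ℕ, A ^ i * S * A ^ k - A ^ k * S * A ^ i ∈ M) {P P' : R}
    (hP : P ∈ Algebra.adjoin ℝ {A}) (hP' : P' ∈ Algebra.adjoin ℝ {A}) :
    P * S * P' - P' * S * P ∈ M := by
  rw [Algebra.adjoin_singleton_eq_range_aeval] at hP hP'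
  obtain ⟨p, rfl⟩ := hP
  obtain ⟨p', rfl⟩ := hP'
  simp only [AlgHom.toRingHom_eq_coe, RingHom.coe_coe]
  induction p using Polynomial.induction_on' with
  | add r s hr hs =>
    have := M.add_mem hr hs
    simp only [map_add, add_mul, mul_add]
    convert this using 1
    abel
  | monomial i r =>
    induction p' using Polynomial.induction_on' with
    | add r s hr hs =>
      have := M.add_mem hr hs
      simp only [map_add, add_mul, mul_add]
      convert this using 1
      abel
    | monomial k s =>
      have := M.smul_mem (r * s) (hM i k)
      simp only [Polynomial.aeval_monomial, ← Algebra.smul_def, smul_mul_assoc, mul_smul_comm]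
      convert this using 1
      module

end Antisymmetric

/-! ### Lifting Hadamard-product identities to diagonal matrices. -/

section Lifting

variable {X : Type*} [Fintype X] [DecidableEq X]

open Matrix in
/-- A linear relation between the maps `N ↦ A ^ i * (E ⊙ (A ^ k * N))` on the algebra generated by
`A` lifts to the diagonal matrices formed by the rows of `E`, if `E` is a multiple of an
idempotent. -/
theorem sum_mul_diagonal_mul_eq_zero {ι : Type*} [Fintype ι] {A E : Matrix X X ℝ} {κ : ℝ}
    (hA : A.IsSymm) (hE : E.IsSymm) (hEE : E * E = κ • E) (p : ι → ℝ) (i k : ι → ℕ)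
    (H : ∀ n : ℕ, ∑ m, p m • (A ^ i m * (E ⊙ (A ^ k m * A ^ n))) = 0) (x : X) :
    ∑ m, p m • (A ^ i m * diagonal (E x) * A ^ k m) = 0 := by
  have hAn : ∀ (n : ℕ) y z, (A ^ n) y z = (A ^ n) z y := fun n y z => (hA.pow n).apply z y
  have hEs : ∀ y z, E y z = E z y := fun y z => hE.apply z y
  set τ : X → X → X → ℝ := fun y t z => ∑ m, p m * ((A ^ i m) y t * (A ^ k m) t z) with hτ
  have hT : ∀ x y z, (∑ m, p m • (A ^ i m * diagonal (E x) * A ^ k m)) y z =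
      ∑ t, E x t * τ y t z := by
    intro x y z
    simp only [hτ, Matrix.sum_apply, Matrix.smul_apply, Matrix.mul_apply (M := _ * _),
      mul_diagonal, Finset.mul_sum, smul_eq_mul]
    rw [Finset.sum_comm]
    refine Finset.sum_congr rfl fun t _ => Finset.sum_congr rfl fun m _ => ?_
    ring
  -- This sum is the (y, t')-entry of the hypothesis `H n`.
  have hS : ∀ y t' n, ∑ z, ∑ t, E t t' * τ y t z * (A ^ n) t' z = 0 := by
    intro y t' n
    have h1 := congrFun (congrFun (H n) y) t'
    simp only [Matrix.sum_apply, Matrix.smul_apply, Matrix.mul_apply, hadamard_apply, smul_eq_mul,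
      Matrix.zero_apply, Finset.mul_sum] at h1
    rw [← h1]
    simp only [hτ, Finset.mul_sum, Finset.sum_mul]
    rw [Finset.sum_comm]
    conv_rhs => rw [Finset.sum_comm]
    refine Finset.sum_congr rfl fun t _ => ?_
    rw [Finset.sum_comm]
    refine Finset.sum_congr rfl fun m _ => Finset.sum_congr rfl fun z _ => ?_
    rw [hAn n t' z]
    ring
  -- Expanding only the second factor τ y t' z produces the sums of `hS`, with n = k m.
  have hquad : ∑ y, ∑ z, ∑ t, ∑ t', E t t' * τ y t z * τ y t' z = 0 := by
    have : ∀ y z t t', E t t' * τ y t z * τ y t' z =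
        ∑ m, p m * (A ^ i m) y t' * (E t t' * τ y t z * (A ^ k m) t' z) := by
      intro y z t t'
      rw [show τ y t' z = ∑ m, p m * ((A ^ i m) y t' * (A ^ k m) t' z) from rfl, Finset.mul_sum]
      refine Finset.sum_congr rfl fun m _ => ?_
      ring
    simp only [this]
    refine Finset.sum_eq_zero fun y _ => ?_
    calc ∑ z, ∑ t, ∑ t', ∑ m, p m * (A ^ i m) y t' * (E t t' * τ y t z * (A ^ k m) t' z)
        = ∑ t', ∑ m, ∑ z, ∑ t,
            p m * (A ^ i m) y t' * (E t t' * τ y t z * (A ^ k m) t' z) := by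
          rw [(Finset.sum_congr rfl fun z _ => Finset.sum_comm :
            (∑ z, ∑ t, ∑ t', ∑ m, p m * (A ^ i m) y t' * (E t t' * τ y t z * (A ^ k m) t' z)) =
              ∑ z, ∑ t', ∑ t, ∑ m, p m * (A ^ i m) y t' * (E t t' * τ y t z * (A ^ k m) t' z)),
            Finset.sum_comm]
          refine Finset.sum_congr rfl fun t' _ => ?_
          rw [Finset.sum_comm (s := (Finset.univ : Finset ι))]
          exact Finset.sum_congr rfl fun z _ => Finset.sum_comm
      _ = 0 := by
          refine Finset.sum_eq_zero fun t' _ => Finset.sum_eq_zero fun m _ => ?_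
          simp only [← Finset.mul_sum, hS, mul_zero]
  -- The entries in question are ∑_t E x t τ y t z; E² = κE evaluates the sum of their squares over
  -- x, so all of these real numbers vanish once the total does.
  have hsq : ∀ y z, ∑ x, (∑ t, E x t * τ y t z) ^ 2 =
      κ * ∑ t, ∑ t', E t t' * τ y t z * τ y t' z := by
    intro y z
    have hEE' : ∀ t t', ∑ x, E x t * E x t' = κ * E t t' := fun t t' => by
      have := congrFun (congrFun hEE t) t'
      simp only [Matrix.mul_apply, Matrix.smul_apply, smul_eq_mul] at this
      rw [← this]
      exact Finset.sum_congr rfl fun x _ => by rw [hEs x t]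
    simp only [pow_two, Finset.sum_mul_sum]
    rw [Finset.sum_comm]
    simp only [Finset.mul_sum]
    refine Finset.sum_congr rfl fun t _ => ?_
    rw [Finset.sum_comm]
    refine Finset.sum_congr rfl fun t' _ => ?_
    rw [show κ * (E t t' * τ y t z * τ y t' z) = κ * E t t' * (τ y t z * τ y t' z) by ring,
      ← hEE', Finset.sum_mul]
    exact Finset.sum_congr rfl fun x _ => by ring
  have hzero : ∑ y, ∑ z, ∑ x, (∑ t, E x t * τ y t z) ^ 2 = 0 := by
    simp only [hsq, ← Finset.mul_sum, hquad, mul_zero]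
  ext y z
  rw [hT, Matrix.zero_apply]
  rw [Finset.sum_eq_zero_iff_of_nonneg fun _ _ => by positivity] at hzero
  have h1 := hzero y (Finset.mem_univ _)
  rw [Finset.sum_eq_zero_iff_of_nonneg fun _ _ => by positivity] at h1
  have h2 := h1 z (Finset.mem_univ _)
  rw [Finset.sum_eq_zero_iff_of_nonneg fun _ _ => by positivity] at h2
  exact pow_eq_zero_iff two_ne_zero |>.1 (h2 x (Finset.mem_univ _))

end Lifting

/-! ### Matrices depending only on distance; the Bose–Mesner algebra is generated by A. -/

section DistFun

variable {X : Type*} {G : SimpleGraph X}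

/-- The matrix whose `(y, z)`-entry is `g (∂(y, z))`. -/
def distFun {R : Type*} (G : SimpleGraph X) (g : ℤ → R) : Matrix X X R :=
  Matrix.of fun y z => g (G.dist y z)

theorem distFun_apply {R : Type*} (g : ℤ → R) (y z : X) :
    distFun G g y z = g (G.dist y z) := rfl

theorem distFun_isSymm {R : Type*} (g : ℤ → R) : (distFun G g).IsSymm := by
  ext y z
  simp [distFun_apply, SimpleGraph.dist_comm]

variable [Fintype X] [DecidableEq X]

theorem distFun_single_zero {R : Type*} [CommRing R] (hG : IsDistanceRegular G) :
    distFun G (Pi.single 0 1 : ℤ → R) = 1 := by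
  ext y z
  by_cases h : y = z
  · subst h; simp [distFun_apply]
  · have : G.dist y z ≠ 0 := fun h0 => h (hG.1.dist_eq_zero_iff.1 h0)
    simp [distFun_apply, h, this]

theorem adj_mul_distFun {R : Type*} [CommRing R] (hG : IsDistanceRegular G) (hD : 1 ≤ G.diam)
    (g : ℤ → R) :
    distFun G (Pi.single 1 1 : ℤ → R) * distFun G g = distFun G fun h =>
      cNum G h.toNat * g (h - 1) + aNum G h.toNat * g h + bNum G h.toNat * g (h + 1) := by
  ext y z
  simp only [Matrix.mul_apply, distFun_apply, Int.toNat_natCast]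
  rw [← hG.sum_adj hD g y z]
  refine Finset.sum_congr rfl fun t _ => ?_
  by_cases h : G.dist y t = 1 <;> simp [h]

theorem adj_mul_single {R : Type*} [CommRing R] (hG : IsDistanceRegular G) (hD : 1 ≤ G.diam)
    (i : ℕ) : distFun G (Pi.single 1 1 : ℤ → R) * distFun G (Pi.single ((i + 1 : ℕ) : ℤ) 1) =
      (cNum G (i + 2) : R) • distFun G (Pi.single ((i + 2 : ℕ) : ℤ) 1 : ℤ → R) +
      (aNum G (i + 1) : R) • distFun G (Pi.single ((i + 1 : ℕ) : ℤ) 1 : ℤ → R) +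
      (bNum G i : R) • distFun G (Pi.single (i : ℤ) 1 : ℤ → R) := by
  rw [adj_mul_distFun hG hD]
  ext y z
  simp only [Matrix.smul_apply, Matrix.add_apply, distFun_apply, smul_eq_mul, Int.toNat_natCast]
  generalize G.dist y z = h
  simp only [Pi.single_apply]
  congr 1
  · congr 1
    · by_cases h1 : h = i + 2
      · subst h1
        rw [if_pos (by omega), if_pos rfl]
      · rw [if_neg (by omega), if_neg (by omega), mul_zero, mul_zero]
    · by_cases h1 : h = i + 1
      · subst h1
        rfl
      · rw [if_neg (by omega), mul_zero, mul_zero]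
  · by_cases h1 : h = i
    · subst h1
      rw [if_pos (by omega), if_pos rfl]
    · rw [if_neg (by omega), if_neg (by omega), mul_zero, mul_zero]

theorem distFun_congr {R : Type*} (hG : IsDistanceRegular G) {g g' : ℤ → R}
    (h : ∀ i : ℕ, i ≤ G.diam → g i = g' i) : distFun G g = distFun G g' := by
  ext y z
  exact h _ (hG.dist_le y z)

/-- A subalgebra containing the adjacency matrix contains all distance matrices. -/
theorem distFun_single_mem {K : Type*} [Field K] [CharZero K] (hG : IsDistanceRegular G)
    (hD : 1 ≤ G.diam) (S : Subalgebra K (Matrix X X K))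
    (hS : distFun G (Pi.single 1 1 : ℤ → K) ∈ S) (i : ℕ) :
    distFun G (Pi.single (i : ℤ) 1 : ℤ → K) ∈ S := by
  suffices H : ∀ i : ℕ, distFun G (Pi.single (i : ℤ) 1 : ℤ → K) ∈ S ∧
      distFun G (Pi.single ((i + 1 : ℕ) : ℤ) 1 : ℤ → K) ∈ S from (H i).1
  intro i
  induction i with
  | zero =>
    refine ⟨?_, by simpa using hS⟩
    rw [Nat.cast_zero, distFun_single_zero hG]
    exact S.one_mem
  | succ i ih =>
    refine ⟨ih.2, ?_⟩
    by_cases hi : i + 1 + 1 ≤ G.diam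
    · have hc : (cNum G (i + 1 + 1) : K) ≠ 0 :=
        Nat.cast_ne_zero.2 (hG.cNum_pos (by omega) hi).ne'
      have key : distFun G (Pi.single ((i + 1 + 1 : ℕ) : ℤ) 1 : ℤ → K) =
          (cNum G (i + 1 + 1) : K)⁻¹ • (distFun G (Pi.single 1 1 : ℤ → K) *
            distFun G (Pi.single ((i + 1 : ℕ) : ℤ) 1 : ℤ → K) -
            (aNum G (i + 1) : K) • distFun G (Pi.single ((i + 1 : ℕ) : ℤ) 1 : ℤ → K) -
            (bNum G i : K) • distFun G (Pi.single (i : ℤ) 1 : ℤ → K)) := by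
        rw [adj_mul_single hG hD, add_sub_right_comm, add_sub_cancel_right, add_sub_cancel_right,
          smul_smul, inv_mul_cancel₀ hc, one_smul]
      rw [key]
      exact S.smul_mem (S.sub_mem (S.sub_mem (S.mul_mem hS ih.2) (S.smul_mem ih.2 _))
        (S.smul_mem ih.1 _)) _
    · have : distFun G (Pi.single ((i + 1 + 1 : ℕ) : ℤ) 1 : ℤ → K) = distFun G 0 :=
        distFun_congr hG fun h hh => by
          rw [Pi.single_eq_of_ne (by omega), Pi.zero_apply]
      rw [this]
      exact S.zero_mem

theorem distFun_mem {K : Type*} [Field K] [CharZero K] (hG : IsDistanceRegular G)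
    (hD : 1 ≤ G.diam) (S : Subalgebra K (Matrix X X K))
    (hS : distFun G (Pi.single 1 1 : ℤ → K) ∈ S) (g : ℤ → K) : distFun G g ∈ S := by
  have : distFun G g = ∑ i ∈ Finset.range (G.diam + 1),
      g i • distFun G (Pi.single (i : ℤ) 1 : ℤ → K) := by
    ext y z
    have := hG.dist_le y z
    rw [Matrix.sum_apply, Finset.sum_eq_single (G.dist y z)]
    · simp [distFun_apply]
    · intro i _ hi
      simp [distFun_apply, hi.symm]
    · intro h
      exact absurd (Finset.mem_range.2 (by omega)) h
  rw [this]
  exact S.sum_mem fun i _ => S.smul_mem (distFun_single_mem hG hD S hS i) _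

end DistFun

/-! ### Classical parameters, the dual adjacency matrix and the balanced set condition. -/

section Classical

variable {X : Type*} [Fintype X] [DecidableEq X] {G : SimpleGraph X} {D : ℕ} {b α β : ℝ}

theorem bracket_eq (hb : b - 1 ≠ 0) (j : ℕ) : bracket b j = (b ^ j - 1) / (b - 1) :=
  geom_sum_eq (sub_ne_zero.1 hb) j

theorem cNum_eq_classicalC (hG : IsDistanceRegular G) (hcl : HasClassicalParameters G D b α β)
    (hD : 1 ≤ D) (hb0 : b ≠ 0) (hb : b - 1 ≠ 0) {h : ℕ} (hh : h ≤ D) :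
    (cNum G h : ℝ) = classicalC b α h := by
  obtain ⟨rfl, hc, -⟩ := hcl
  rcases h with - | h
  · simp [hG.cNum_zero hD, classicalC]
  · rw [hc _ (by omega) hh, bracket_eq hb, bracket_eq hb, classicalC, zpow_natCast,
      Nat.add_sub_cancel, pow_succ, mul_div_cancel_right₀ _ hb0]

/-- The choice Q = b^D makes the closed formula vanish at h = D, in agreement with b_D = 0. -/
theorem bNum_eq_classicalB (hG : IsDistanceRegular G) (hcl : HasClassicalParameters G D b α β)
    (hb : b - 1 ≠ 0) {h : ℕ} (hh : h ≤ D) :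
    (bNum G h : ℝ) = classicalB b α β (b ^ D) h := by
  obtain ⟨rfl, -, hB⟩ := hcl
  rcases hh.lt_or_eq with h1 | rfl
  · rw [hB _ h1, bracket_eq hb, bracket_eq hb, classicalB, zpow_natCast]
    ring
  · simp [hG.bNum_diam, classicalB]

theorem aNum_eq_shiftedA (hG : IsDistanceRegular G) (hcl : HasClassicalParameters G D b α β)
    (hD : 1 ≤ D) (hb0 : b ≠ 0) (hb : b - 1 ≠ 0) {h : ℕ} (hh : h ≤ D) :
    (aNum G h : ℝ) = shiftedA b α β (b ^ D) h + eigShift b α β (b ^ D) := by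
  have h0 := hG.add_num (h := h) (by rw [hcl.1]; exact hD) (by rw [hcl.1]; exact hh)
  have h1 : (cNum G h + aNum G h + bNum G h : ℝ) = bNum G 0 := by exact_mod_cast h0
  have h2 := bNum_eq_classicalB hG hcl hb (Nat.zero_le D)
  rw [Nat.cast_zero] at h2
  rw [h2, cNum_eq_classicalC hG hcl hD hb0 hb hh, bNum_eq_classicalB hG hcl hb hh] at h1
  rw [shiftedA_eq hb0 hb]
  linarith

/-- The adjacency matrix shifted by the constant term of the eigenvalues. -/
def shiftedAdj (G : SimpleGraph X) (s : ℝ) : Matrix X X ℝ :=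
  distFun G (Pi.single 1 1 : ℤ → ℝ) - s • 1

/-- Transfers sequence identities to matrices. The closed formulas are intersection numbers only for
0 ≤ h ≤ D, but entries see no other h. -/
theorem shiftedAdj_mul_distFun (hG : IsDistanceRegular G)
    (hcl : HasClassicalParameters G D b α β) (hD : 1 ≤ D) (hb0 : b ≠ 0) (hb : b - 1 ≠ 0)
    (g : ℤ → ℝ) : shiftedAdj G (eigShift b α β (b ^ D)) * distFun G g =
      distFun G (shiftedOp b α β (b ^ D) g) := by
  rw [shiftedAdj, sub_mul, smul_mul_assoc, one_mul, adj_mul_distFun hG (by rw [hcl.1]; exact hD)]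
  ext y z
  have hh : G.dist y z ≤ D := hcl.1 ▸ hG.dist_le y z
  simp only [Matrix.sub_apply, Matrix.smul_apply, distFun_apply, smul_eq_mul, Int.toNat_natCast,
    shiftedOp, threeTerm_apply]
  rw [cNum_eq_classicalC hG hcl hD hb0 hb hh, bNum_eq_classicalB hG hcl hb hh,
    aNum_eq_shiftedA hG hcl hD hb0 hb hh]
  ring

theorem shiftedAdj_pow_mul_distFun (hG : IsDistanceRegular G)
    (hcl : HasClassicalParameters G D b α β) (hD : 1 ≤ D) (hb0 : b ≠ 0) (hb : b - 1 ≠ 0)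
    (n : ℕ) (g : ℤ → ℝ) : shiftedAdj G (eigShift b α β (b ^ D)) ^ n * distFun G g =
      distFun G ((shiftedOp b α β (b ^ D) ^ n) g) := by
  induction n generalizing g with
  | zero => simp
  | succ n ih =>
    rw [pow_succ, pow_succ, mul_assoc, shiftedAdj_mul_distFun hG hcl hD hb0 hb, ih,
      Module.End.mul_apply]

theorem shiftedAdj_pow (hG : IsDistanceRegular G)
    (hcl : HasClassicalParameters G D b α β) (hD : 1 ≤ D) (hb0 : b ≠ 0) (hb : b - 1 ≠ 0)
    (n : ℕ) : shiftedAdj G (eigShift b α β (b ^ D)) ^ n =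
      distFun G ((shiftedOp b α β (b ^ D) ^ n) (Pi.single 0 1)) := by
  rw [← shiftedAdj_pow_mul_distFun hG hcl hD hb0 hb, distFun_single_zero hG, mul_one]

theorem distFun_mem_adjoin_shiftedAdj (hG : IsDistanceRegular G) (hD : 1 ≤ G.diam) (s : ℝ)
    (g : ℤ → ℝ) : distFun G g ∈ Algebra.adjoin ℝ {shiftedAdj G s} := by
  refine distFun_mem hG hD _ ?_ g
  have h1 : shiftedAdj G s ∈ Algebra.adjoin ℝ {shiftedAdj G s} :=
    Algebra.subset_adjoin (Set.mem_singleton _)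
  have h2 := add_mem h1 (Subalgebra.smul_mem _ (one_mem (Algebra.adjoin ℝ {shiftedAdj G s})) s)
  simpa [shiftedAdj] using h2

open Matrix in
/-- The tridiagonal relation between the adjacency matrix and a dual adjacency matrix. -/
theorem exists_tridiagonal (hG : IsDistanceRegular G) (hcl : HasClassicalParameters G D b α β)
    (hD : 2 ≤ D) (hb : b < -1) : ∃ ξ : ℝ, ∀ x : X, ∀ A S : Matrix X X ℝ,
      A = shiftedAdj G (eigShift b α β (b ^ D)) →
      S = diagonal (fun t => dualSeq b ξ (G.dist x t)) →
      A ^ 3 * S - S * A ^ 3 - (b + 1 / b + 1) • (A ^ 2 * S * A - A * S * A ^ 2) -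
        tdRho b α β (b ^ D) • (A * S - S * A) = 0 := by
  have hb0 : b ≠ 0 := by linarith
  have hb1 : b - 1 ≠ 0 := by linarith
  have hD1 : 1 ≤ D := by omega
  -- This is b_0 ≠ θ_1: here θ_1 = b_1/b - 1 ≤ -1 < 0 ≤ b_0 since b < 0.
  have hden : classicalB b α β (b ^ D) 0 - eigShift b α β (b ^ D) -
      (eigPos b α * b + eigNeg b α β (b ^ D) / b) ≠ 0 := by
    have h0 := bNum_eq_classicalB hG hcl hb1 (Nat.zero_le D)
    have h1 := bNum_eq_classicalB hG hcl hb1 hD1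
    have h2 : eigPos b α * b + eigNeg b α β (b ^ D) / b + eigShift b α β (b ^ D) =
        classicalB b α β (b ^ D) (1 : ℕ) / b - 1 := by
      simp only [classicalB, eigPos, eigNeg, eigShift, Nat.cast_one, zpow_one]
      field_simp
      ring
    rw [← h1] at h2
    rw [Nat.cast_zero] at h0
    rw [← h0]
    have h3 : (bNum G 1 : ℝ) / b ≤ 0 :=
      div_nonpos_of_nonneg_of_nonpos (Nat.cast_nonneg _) (by linarith)
    have h4 : (0 : ℝ) ≤ bNum G 0 := Nat.cast_nonneg _
    intro h5
    linarith
  -- ξ solves row h = 0 of the eigenvector equation for θ_1.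
  obtain ⟨ξ, hξ⟩ : ∃ ξ, ξ * (classicalB b α β (b ^ D) 0 - eigShift b α β (b ^ D) -
      (eigPos b α * b + eigNeg b α β (b ^ D) / b)) +
      (shiftedA b α β (b ^ D) 0 + classicalB b α β (b ^ D) 0 / b -
        (eigPos b α * b + eigNeg b α β (b ^ D) / b)) = 0 :=
    ⟨-(shiftedA b α β (b ^ D) 0 + classicalB b α β (b ^ D) 0 / b -
        (eigPos b α * b + eigNeg b α β (b ^ D) / b)) / _, by rw [div_mul_cancel₀ _ hden]; ring⟩
  refine ⟨ξ, fun x A S hA hS => ?_⟩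
  set E : Matrix X X ℝ := distFun G (dualSeq b ξ) with hE
  have hSE : S = diagonal (E x) := hS
  have hAE : A * E = (eigPos b α * b + eigNeg b α β (b ^ D) / b) • E := by
    rw [hA, shiftedAdj_mul_distFun hG hcl hD1 hb0 hb1]
    ext y z
    simp only [distFun_apply, Matrix.smul_apply, smul_eq_mul, hE]
    exact shiftedOp_dualSeq hb0 hb1 α β (b ^ D) ξ hξ _
  have hscal : ∀ P ∈ Algebra.adjoin ℝ {A}, ∃ κ : ℝ, P * E = κ • E := by
    intro P hP
    induction hP using Algebra.adjoin_induction with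
    | mem P hP => rw [Set.mem_singleton_iff.1 hP]; exact ⟨_, hAE⟩
    | algebraMap r => exact ⟨r, by rw [Algebra.algebraMap_eq_smul_one, smul_mul_assoc, one_mul]⟩
    | add P P' _ _ h h' =>
      obtain ⟨κ, h⟩ := h
      obtain ⟨κ', h'⟩ := h'
      exact ⟨κ + κ', by rw [add_mul, h, h', add_smul]⟩
    | mul P P' _ _ h h' =>
      obtain ⟨κ, h⟩ := h
      obtain ⟨κ', h'⟩ := h'
      exact ⟨κ' * κ, by rw [mul_assoc, h', mul_smul_comm, h, smul_smul]⟩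
  -- E is itself a polynomial in A, and such polynomials act on E as scalars; so E² is a multiple of
  -- E.
  obtain ⟨κ, hκ⟩ := hscal E (by
    rw [hA]; exact distFun_mem_adjoin_shiftedAdj hG (by rw [hcl.1]; exact hD1) _ _)
  have hsymm : A.IsSymm := by
    rw [hA, shiftedAdj]
    exact (distFun_isSymm _).sub ((Matrix.isSymm_one).smul _)
  -- The lists give, for the six terms of the relation, the coefficient and the exponents of A to
  -- the left and right of S.
  have key := sum_mul_diagonal_mul_eq_zero (E := E) hsymm (distFun_isSymm _) hκ
    ![1, -1, -(b + 1 / b + 1), b + 1 / b + 1, -tdRho b α β (b ^ D), tdRho b α β (b ^ D)]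
    ![3, 0, 2, 1, 1, 0] ![0, 3, 1, 2, 0, 1] ?_ x
  · simp only [Fin.sum_univ_six, ← hSE] at key
    simp at key
    rw [← key]
    module
  · intro n
    have hhad : ∀ g, E ⊙ distFun G g = distFun G (mulOp (dualSeq b ξ) g) := fun g => rfl
    have htd := LinearMap.congr_fun (tridiagonal_op hb0 hb1 α β (b ^ D) ξ)
      ((shiftedOp b α β (b ^ D) ^ n) (Pi.single 0 1))
    simp only [hA, shiftedAdj_pow hG hcl hD1 hb0 hb1 n,
      shiftedAdj_pow_mul_distFun hG hcl hD1 hb0 hb1, hhad]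
    ext y z
    have htd' := congrFun htd (G.dist y z)
    simp only [LinearMap.sub_apply, LinearMap.smul_apply, Module.End.mul_apply, Pi.sub_apply,
      Pi.smul_apply, LinearMap.zero_apply, Pi.zero_apply, smul_eq_mul] at htd'
    simp [Fin.sum_univ_six, distFun_apply]
    simp at htd'
    linear_combination htd'

/-- |Γ_h(x)| = p^0_{hh} is the same for every x, and is positive for some x. -/
theorem IsDistanceRegular.exists_dist_eq_of_vertex (hG : IsDistanceRegular G) {h : ℕ}
    (hh : h ≤ G.diam) (x : X) : ∃ z, G.dist x z = h := by
  obtain ⟨y, z, hyz⟩ := hG.exists_dist_eq hh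
  have h1 := hG.2 0 h h (Nat.zero_le _) hh hh x x y y (by simp) (by simp)
  have h2 : 0 < (sphere G y h ∩ sphere G y h).card :=
    Finset.card_pos.2 ⟨z, by simp [sphere, hyz]⟩
  rw [← h1] at h2
  obtain ⟨w, hw⟩ := Finset.card_pos.1 h2
  exact ⟨w, by simpa [sphere] using hw⟩

/-- The balanced set condition for the sets `Γ(y) ∩ Γ_j(z)` and `Γ_j(y) ∩ Γ(z)`, where
`∂(y, z) = j`. -/
theorem balanced_set (hG : IsDistanceRegular G) (hcl : HasClassicalParameters G D b α β)
    (hD : 2 ≤ D) (hb : b < -1) : ∃ ξ : ℝ, ∀ j ≤ D, ∀ x : X, ∃ r : ℝ, ∀ y z : X,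
      G.dist y z = j →
      ∑ t, (if G.dist y t = 1 ∧ G.dist t z = j then dualSeq b ξ (G.dist x t) else 0) -
        ∑ t, (if G.dist z t = 1 ∧ G.dist t y = j then dualSeq b ξ (G.dist x t) else 0) =
      r * (dualSeq b ξ (G.dist x y) - dualSeq b ξ (G.dist x z)) := by
  have hb0 : b ≠ 0 := by linarith
  have hb1 : b - 1 ≠ 0 := by linarith
  have hD1 : 1 ≤ D := by omega
  have hdiam : 1 ≤ G.diam := by rw [hcl.1]; exact hD1
  obtain ⟨ξ, hξ⟩ := exists_tridiagonal hG hcl hD hb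
  refine ⟨ξ, fun j hj x => ?_⟩
  set A := shiftedAdj G (eigShift b α β (b ^ D)) with hA
  set S : Matrix X X ℝ := Matrix.diagonal (fun t => dualSeq b ξ (G.dist x t)) with hS
  let φ : (ℤ → ℝ) →ₗ[ℝ] Matrix X X ℝ :=
    { toFun := fun g => distFun G g * S - S * distFun G g
      map_add' := fun g g' => by
        have : distFun G (g + g') = distFun G g + distFun G g' := rfl
        rw [this]; noncomm_ring
      map_smul' := fun r g => by
        have : distFun G (r • g) = r • distFun G g := rfl
        rw [this]; simp [smul_sub] }
  have hq : ∀ n : ℕ, n ≠ 0 → b ^ n ≠ 1 := by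
    intro n hn h
    have h1 : |b| ^ n = 1 := by rw [← abs_pow, h, abs_one]
    have h2 : 1 < |b| := by rw [abs_of_neg (by linarith)]; linarith
    exact (one_lt_pow₀ h2 hn).ne' h1
  -- The range of φ contains every [A^n, S], and both A and A_j are polynomials in the shifted
  -- adjacency matrix.
  have hmem := mul_mul_sub_mem_of_mem_adjoin (A := A) (S := S) (LinearMap.range φ)
    (fun i k => pow_mul_pow_sub_mem hb0 hq (hξ x A S rfl rfl) (LinearMap.range φ)
      (fun n => ⟨(shiftedOp b α β (b ^ D) ^ n) (Pi.single 0 1), by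
        rw [hA, shiftedAdj_pow hG hcl hD1 hb0 hb1]; rfl⟩) _ i k rfl)
    (distFun_mem_adjoin_shiftedAdj hG hdiam _ (Pi.single 1 1))
    (distFun_mem_adjoin_shiftedAdj hG hdiam _ (Pi.single (j : ℤ) 1))
  obtain ⟨g, hg⟩ := hmem
  -- The (y, z)-entry of [`distFun G g`, S] is g(j)(S_z - S_y), so r depends on j and x but not on
  -- the pair y, z.
  refine ⟨-g j, fun y z hyz => ?_⟩
  have h1 := congrFun (congrFun hg y) z
  simp only [φ, LinearMap.coe_mk, AddHom.coe_mk, Matrix.sub_apply, hS, Matrix.mul_diagonal,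
    Matrix.diagonal_mul, distFun_apply, hyz, Matrix.mul_apply (M := _ * _)] at h1
  have e1 : ∀ t, (Pi.single 1 1 : ℤ → ℝ) (G.dist y t) * dualSeq b ξ (G.dist x t) *
      (Pi.single (j : ℤ) 1 : ℤ → ℝ) (G.dist t z) =
      if G.dist y t = 1 ∧ G.dist t z = j then dualSeq b ξ (G.dist x t) else 0 := fun t => by
    by_cases h2 : G.dist y t = 1 <;> by_cases h3 : G.dist t z = j <;>
      simp [h2, h3]
  have e2 : ∀ t, (Pi.single (j : ℤ) 1 : ℤ → ℝ) (G.dist y t) * dualSeq b ξ (G.dist x t) *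
      (Pi.single 1 1 : ℤ → ℝ) (G.dist t z) =
      if G.dist z t = 1 ∧ G.dist t y = j then dualSeq b ξ (G.dist x t) else 0 := fun t => by
    rw [SimpleGraph.dist_comm (u := y), SimpleGraph.dist_comm (u := t) (v := z)]
    by_cases h2 : G.dist z t = 1 <;> by_cases h3 : G.dist t y = j <;>
      simp [h2, h3]
  simp only [e1, e2] at h1
  rw [← h1]
  ring

end Classical

/-! ### Nonexistence of kites. -/

section Kites

theorem sum_ite_two_values {X : Type*} [Fintype X] (P Q : X → Prop) [DecidablePred P]
    [DecidablePred Q] (F : X → ℝ) (c c' : ℝ) (h : ∀ t, P t → Q t → F t = c)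
    (h' : ∀ t, P t → ¬Q t → F t = c') :
    ∑ t, (if P t then F t else 0) = ((Finset.univ.filter fun t => P t ∧ Q t).card : ℝ) * (c - c') +
      ((Finset.univ.filter P).card : ℝ) * c' := by
  simp only [Finset.card_filter, Nat.cast_sum, Finset.sum_mul, ← Finset.sum_add_distrib]
  refine Finset.sum_congr rfl fun t _ => ?_
  by_cases h1 : P t <;> by_cases h2 : Q t
  · simp [h1, h2, h t h1 h2]
  · simp [h1, h2, h' t h1 h2]
  · simp [h1]
  · simp [h1]

variable {X : Type*} [Fintype X] [DecidableEq X] {G : SimpleGraph X} {D : ℕ} {b α β : ℝ}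

/-- The balanced set condition at distance j+1 is used for two pairs with the same base vertex x.
For (x, z') all distances from x are known, which determines r. For (y, z) they take the values 1, 2
in one set and j+1, j+2 in the other. As θ* is affine in b^{-h}, the a_{j+1}-terms cancel, leaving
s(θ*_1 - θ*_2) = m(θ*_{j+1} - θ*_{j+2}). -/
theorem card_eq_pow_mul_card (hG : IsDistanceRegular G) (hcl : HasClassicalParameters G D b α β)
    (hD : 2 ≤ D) (hb : b < -1) {j : ℕ} (hj : j + 1 < D) {x y z : X} (hxy : G.dist x y = 1)
    (hyz : G.dist y z = j + 1) (hxz : G.dist x z = j + 2) :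
    ((Finset.univ.filter fun t => (G.dist z t = 1 ∧ G.dist t y = j + 1) ∧
        G.dist x t = j + 1).card : ℝ) =
      b ^ j * (Finset.univ.filter fun t => (G.dist y t = 1 ∧ G.dist t z = j + 1) ∧
        G.dist x t = 1).card := by
  have hb0 : b ≠ 0 := by linarith
  have hb1 : b - 1 ≠ 0 := by linarith
  have hdiam : 1 ≤ G.diam := by rw [hcl.1]; omega
  obtain ⟨ξ, hξ⟩ := balanced_set hG hcl hD hb
  obtain ⟨r, hr⟩ := hξ (j + 1) (by omega) x
  obtain ⟨z', hz'⟩ := hG.exists_dist_eq_of_vertex (h := j + 1) (by rw [hcl.1]; omega) x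
  have ca : ∀ u v, G.dist u v = j + 1 →
      ((Finset.univ.filter fun t => G.dist u t = 1 ∧ G.dist t v = j + 1).card : ℝ) =
        aNum G (j + 1) := fun u v huv => by
    have := hG.card_aNum hdiam u v
    rw [huv] at this
    rw [this]
  have h1 := hr x z' hz'
  rw [sum_ite_two_values _ (fun _ => True) _ (dualSeq b ξ (1 : ℕ)) 0 (fun t ht _ => by rw [ht.1])
      (fun _ _ h => absurd trivial h),
    sum_ite_two_values _ (fun _ => True) _ (dualSeq b ξ (j + 1 : ℕ)) 0
      (fun t ht _ => by rw [SimpleGraph.dist_comm, ht.2]) (fun _ _ h => absurd trivial h)] at h1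
  simp only [and_true, mul_zero, add_zero, sub_zero] at h1
  rw [ca x z' hz', ca z' x (by rw [SimpleGraph.dist_comm, hz']), SimpleGraph.dist_self, hz'] at h1
  have h2 := hr y z hyz
  rw [sum_ite_two_values _ (fun t => G.dist x t = 1) _ (dualSeq b ξ (1 : ℕ))
      (dualSeq b ξ (2 : ℕ)) (fun t _ ht => by rw [ht])
      (fun t ht hn => by
        have e1 := hG.1.dist_triangle (u := x) (v := y) (w := t)
        -- Distance 0 is impossible: x is at distance j+2 from z, but t is at distance j+1.
        have e2 : G.dist x t ≠ 0 := fun h => by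
          have e3 := hG.1.dist_eq_zero_iff.1 h
          subst e3
          omega
        rw [show G.dist x t = 2 by omega]),
    sum_ite_two_values _ (fun t => G.dist x t = j + 1) _ (dualSeq b ξ (j + 1 : ℕ))
      (dualSeq b ξ (j + 2 : ℕ)) (fun t _ ht => by rw [ht])
      (fun t ht hn => by
        have e1 := hG.1.dist_triangle (u := x) (v := y) (w := t)
        have e2 := hG.1.dist_triangle (u := x) (v := t) (w := z)
        rw [SimpleGraph.dist_comm (u := y)] at e1
        rw [SimpleGraph.dist_comm (u := t)] at e2
        rw [show G.dist x t = j + 2 by omega]),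
    ca y z hyz, ca z y (by rw [SimpleGraph.dist_comm, hyz]), hxy, hxz] at h2
  generalize ((Finset.univ.filter fun t => (G.dist z t = 1 ∧ G.dist t y = j + 1) ∧
        G.dist x t = j + 1).card : ℝ) = m at *
  generalize ((Finset.univ.filter fun t => (G.dist y t = 1 ∧ G.dist t z = j + 1) ∧
        G.dist x t = 1).card : ℝ) = s at *
  simp only [dualSeq, zpow_natCast, pow_succ, pow_zero, one_mul] at h1 h2
  have hY : b ^ j ≠ 0 := pow_ne_zero _ hb0
  generalize b ^ j = Y at *
  have h3 : (b - 1) * (m - Y * s) = 0 := by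
    field_simp at h1 h2
    linear_combination (-1 : ℝ) * h2 + h1
  have := (mul_eq_zero.1 h3).resolve_left hb1
  linarith

/-- For odd j the factor b^j is negative, so both cardinalities must be 0. -/
theorem no_kite_of_odd (hG : IsDistanceRegular G) (hcl : HasClassicalParameters G D b α β)
    (hD : 2 ≤ D) (hb : b < -1) {j : ℕ} (hj : Odd j) {x y t z : X} (hxy : G.dist x y = 1)
    (hyt : G.dist y t = 1) (hxt : G.dist x t = 1) (hxz : G.dist x z = j + 2)
    (hyz : G.dist y z = j + 1) (htz : G.dist t z = j + 1) : False := by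
  have hle := hG.dist_le x z
  rw [hcl.1] at hle
  have h1 := card_eq_pow_mul_card hG hcl hD hb (by omega) hxy hyz hxz
  have h2 : 0 < (Finset.univ.filter fun t => (G.dist y t = 1 ∧ G.dist t z = j + 1) ∧
      G.dist x t = 1).card := Finset.card_pos.2 ⟨t, by simp [hyt, htz, hxt]⟩
  have h3 : b ^ j < 0 := hj.pow_neg (by linarith)
  have h4 := mul_neg_of_neg_of_pos h3 (Nat.cast_pos (α := ℝ).2 h2)
  rw [← h1] at h4
  exact absurd h4 (not_lt.2 (Nat.cast_nonneg _))

/-- As D ≥ 3, some neighbour w of z has distance 3 from x; with w in place of z the kite has length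
3, which is odd. -/
theorem no_kite_two (hG : IsDistanceRegular G) (hcl : HasClassicalParameters G D b α β)
    (hD : 3 ≤ D) (hb : b < -1) {x y t z : X} (hxy : G.dist x y = 1)
    (hyt : G.dist y t = 1) (hxt : G.dist x t = 1) (hxz : G.dist x z = 2)
    (hyz : G.dist y z = 1) (htz : G.dist t z = 1) : False := by
  obtain ⟨w, hw1, hw2⟩ := hG.exists_next (y := z) (z := x)
    (by rw [SimpleGraph.dist_comm, hxz, hcl.1]; omega)
  rw [SimpleGraph.dist_comm (u := z) (v := x), hxz, SimpleGraph.dist_comm] at hw2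
  have e1 := hG.1.dist_triangle (u := x) (v := y) (w := w)
  have e2 := hG.1.dist_triangle (u := x) (v := t) (w := w)
  have e3 := hG.1.dist_triangle (u := y) (v := z) (w := w)
  have e4 := hG.1.dist_triangle (u := t) (v := z) (w := w)
  exact no_kite_of_odd hG hcl (by omega) hb (j := 1) odd_one hxy hyt hxt (by omega) (by omega)
    (by omega) (z := w)

/-- From c_2 ≥ 1 one gets α(1+b) ≥ -b, hence 1 + α[j 1] ≥ 1 - b for even j ≥ 2. So c_{j+1} ≥ [j+1
1](1-b) = 1 - b^{j+1}, which exceeds b^j as b < -1. -/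
theorem pow_lt_cNum (hG : IsDistanceRegular G) (hcl : HasClassicalParameters G D b α β)
    (hb : b < -1) {j : ℕ} (hj : Even j) (hj2 : 2 ≤ j) (hjD : j + 1 ≤ D) :
    b ^ j < cNum G (j + 1) := by
  have hb1 : b - 1 ≠ 0 := by linarith
  have hc2 : (1 : ℝ) ≤ (1 + b) * (1 + α) := by
    have h1 := hcl.2.1 2 (by omega) (by omega)
    have h2 : 1 ≤ cNum G 2 := hG.cNum_pos (by omega) (by rw [hcl.1]; omega)
    have h3 : (1 : ℝ) ≤ cNum G 2 := by exact_mod_cast h2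
    rw [h1] at h3
    simpa [bracket, Finset.sum_range_succ] using h3
  have hP : b ^ 2 ≤ b ^ j := by
    rw [← hj.pow_abs, ← (even_two).pow_abs]
    exact pow_le_pow_right₀ (by rw [abs_of_neg (by linarith)]; linarith) hj2
  rw [hcl.2.1 (j + 1) (by omega) hjD, Nat.add_sub_cancel, bracket_eq hb1, bracket_eq hb1, pow_succ]
  generalize b ^ j = P at *
  have hb2 : 0 < b ^ 2 - 1 := by nlinarith
  have h1 : 1 - b ≤ 1 + α * ((P - 1) / (b - 1)) := by
    have e : α * ((P - 1) / (b - 1)) = α * (1 + b) * ((P - 1) / (b ^ 2 - 1)) := by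
      have hb3 : b + 1 ≠ 0 := by linarith
      rw [show b ^ 2 - 1 = (b - 1) * (b + 1) by ring]
      field_simp
      ring
    have h2 : 1 ≤ (P - 1) / (b ^ 2 - 1) := by
      rw [le_div_iff₀ hb2]
      linarith
    rw [e]
    nlinarith
  have h3 : (P * b - 1) / (b - 1) * (1 - b) = 1 - P * b := by
    field_simp
    ring
  have h4 : 0 ≤ (P * b - 1) / (b - 1) :=
    div_nonneg_of_nonpos (by nlinarith) (by linarith)
  have h5 := mul_le_mul_of_nonneg_left h1 h4
  rw [h3] at h5
  nlinarith

/-- Each u in s has c_{j+1} neighbours v of z at distance j from u. These v all lie in the set of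
size b^j |s|, and different u give different v, so |s| c_{j+1} ≤ b^j |s|, against `pow_lt_cNum`
unless s is empty. -/
theorem no_kite_of_even (hG : IsDistanceRegular G) (hcl : HasClassicalParameters G D b α β)
    (hD : 3 ≤ D) (hb : b < -1) {j : ℕ} (hj : Even j) (hj2 : 2 ≤ j) {x y t z : X}
    (hxy : G.dist x y = 1) (hyt : G.dist y t = 1) (hxt : G.dist x t = 1)
    (hxz : G.dist x z = j + 2) (hyz : G.dist y z = j + 1) (htz : G.dist t z = j + 1) : False := by
  have hle := hG.dist_le x z
  rw [hcl.1] at hle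
  have hodd : Odd (j - 1) := Nat.Even.sub_odd (by omega) hj odd_one
  have h1 := card_eq_pow_mul_card hG hcl (by omega) hb (by omega) hxy hyz hxz
  set s := Finset.univ.filter fun t => (G.dist y t = 1 ∧ G.dist t z = j + 1) ∧ G.dist x t = 1
    with hs
  have h2 : 0 < s.card := Finset.card_pos.2 ⟨t, by simp [hs, hyt, htz, hxt]⟩
  have hlt := pow_lt_cNum hG hcl hb hj hj2 (by omega)
  have hsub : s.biUnion (fun u => Finset.univ.filter fun v => G.dist z v = 1 ∧
        G.dist v u + 1 = G.dist z u) ⊆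
      Finset.univ.filter fun t => (G.dist z t = 1 ∧ G.dist t y = j + 1) ∧
        G.dist x t = j + 1 := by
    intro v hv
    simp only [hs, Finset.mem_biUnion, Finset.mem_filter, Finset.mem_univ, true_and] at hv ⊢
    obtain ⟨u, ⟨⟨hyu, huz⟩, hxu⟩, hzv, hvu⟩ := hv
    rw [SimpleGraph.dist_comm (u := z) (v := u), SimpleGraph.dist_comm (u := v)] at hvu
    have e1 := hG.1.dist_triangle (u := x) (v := v) (w := z)
    have e2 := hG.1.dist_triangle (u := x) (v := u) (w := v)
    have e3 := hG.1.dist_triangle (u := y) (v := v) (w := z)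
    have e4 := hG.1.dist_triangle (u := y) (v := u) (w := v)
    rw [SimpleGraph.dist_comm (u := v)] at e1 e3
    refine ⟨⟨hzv, ?_⟩, by omega⟩
    -- If v were at distance j from y, then x, y, u, v would form a kite of odd length j+1.
    by_contra hne
    rw [SimpleGraph.dist_comm] at hne
    exact no_kite_of_odd hG hcl (by omega) hb hodd hxy hyu hxu (z := v) (by omega) (by omega)
      (by omega)
  have hdisj : (s : Set X).PairwiseDisjoint fun u => Finset.univ.filter fun v =>
      G.dist z v = 1 ∧ G.dist v u + 1 = G.dist z u := by
    intro u hu u' hu' hne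
    refine Finset.disjoint_left.2 fun v hv hv' => ?_
    simp only [hs, Finset.coe_filter, Finset.mem_filter, Finset.mem_univ, true_and,
      Set.mem_ofPred_eq] at hu hu' hv hv'
    obtain ⟨⟨hyu, huz⟩, hxu⟩ := hu
    obtain ⟨⟨hyu', huz'⟩, hxu'⟩ := hu'
    obtain ⟨hzv, hvu⟩ := hv
    obtain ⟨-, hvu'⟩ := hv'
    rw [SimpleGraph.dist_comm (u := z), SimpleGraph.dist_comm (u := v)] at hvu hvu'
    have e0 : G.dist u u' ≠ 0 := fun h => hne (hG.1.dist_eq_zero_iff.1 h)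
    have e1 := hG.1.dist_triangle (u := u) (v := x) (w := u')
    have e2 := hG.1.dist_triangle (u := x) (v := v) (w := z)
    have e3 := hG.1.dist_triangle (u := x) (v := u) (w := v)
    rw [SimpleGraph.dist_comm (u := v)] at e2
    have hux : G.dist u x = 1 := by rw [SimpleGraph.dist_comm, hxu]
    have huy : G.dist u y = 1 := by rw [SimpleGraph.dist_comm, hyu]
    -- Adjacent u, u' give the odd kite x, u, u', v; otherwise u, x, y, u' is a kite of length 2.
    by_cases h : G.dist u u' = 1
    · exact no_kite_of_odd hG hcl (by omega) hb hodd hxu h hxu' (z := v) (by omega) (by omega)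
        (by omega)
    · exact no_kite_two hG hcl hD hb hux hxy huy (by omega) hxu' hyu'
  have hcard := Finset.card_le_card hsub
  rw [Finset.card_biUnion hdisj, Finset.sum_congr rfl fun u hu => (by
    rw [hG.card_cNum (by rw [hcl.1]; omega)]
    simp only [hs, Finset.mem_filter, Finset.mem_univ, true_and] at hu
    rw [SimpleGraph.dist_comm, hu.1.2] : _ = cNum G (j + 1)), Finset.sum_const,
    smul_eq_mul] at hcard
  have hcard' : (s.card : ℝ) * cNum G (j + 1) ≤ b ^ j * s.card := by
    rw [← h1]
    exact_mod_cast hcard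
  have h3 : (0 : ℝ) < s.card := Nat.cast_pos.2 h2
  nlinarith

/-- A distance-regular graph of negative type has no kites. -/
theorem no_kite (hG : IsDistanceRegular G) (hcl : HasClassicalParameters G D b α β)
    (hD : 3 ≤ D) (hb : b < -1) {j : ℕ} {x y t z : X}
    (hxy : G.dist x y = 1) (hyt : G.dist y t = 1) (hxt : G.dist x t = 1)
    (hxz : G.dist x z = j + 2) (hyz : G.dist y z = j + 1) (htz : G.dist t z = j + 1) : False := by
  rcases Nat.even_or_odd j with h | h
  · rcases Nat.eq_zero_or_pos j with rfl | h0
    · exact no_kite_two hG hcl hD hb hxy hyt hxt hxz hyz htz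
    · exact no_kite_of_even hG hcl hD hb h (by obtain ⟨k, rfl⟩ := h; omega) hxy hyt hxt hxz hyz htz
  · exact no_kite_of_odd hG hcl (by omega) hb h hxy hyt hxt hxz hyz htz

end Kites

/-! ### The action of A on the vectors E*_i A_{i-1} w. -/

section LocalVector

variable {X : Type*} {G : SimpleGraph X}

theorem distMatrix_eq (j : ℕ) : distMatrix G j = distFun G (Pi.single (j : ℤ) 1 : ℤ → ℂ) := by
  ext y z
  simp [distMatrix, distFun_apply, Pi.single_apply]

variable [Fintype X]

theorem distMatrix_mulVec (j : ℕ) (w : X → ℂ) (y : X) :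
    (distMatrix G j).mulVec w y = ∑ t, if G.dist y t = j then w t else 0 := by
  simp [Matrix.mulVec, dotProduct, distMatrix]

variable [DecidableEq X] {D : ℕ} {b α β : ℝ}

theorem dualIdempotent_mulVec (x : X) (i : ℕ) (w : X → ℂ) (y : X) :
    (dualIdempotent G x i).mulVec w y = if G.dist x y = i then w y else 0 := by
  simp [dualIdempotent, Matrix.mulVec_diagonal]

/-- A vector supported on `Γ(x)` with sum `0`, and an eigenvector of the local graph at `x` with
eigenvalue `-1`. -/
structure IsLocalVector (G : SimpleGraph X) (x : X) (w : X → ℂ) : Prop where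
  eq_zero : ∀ t, G.dist x t ≠ 1 → w t = 0
  sum_eq_zero : ∑ t, w t = 0
  sum_adj : ∀ t, G.dist x t = 1 → ∑ u, (if G.dist t u = 1 then w u else 0) = -w t

/-- The indicator F of the far vertices is constant along edges of the local graph, hence behaves as
an eigenvector for a_1, while w has eigenvalue -1. Since a_1 ≠ -1, they are orthogonal. -/
theorem IsLocalVector.sum_far (hG : IsDistanceRegular G)
    (hcl : HasClassicalParameters G D b α β) (hD : 3 ≤ D) (hb : b < -1) {x : X} {w : X → ℂ}
    (hw : IsLocalVector G x w) {y : X} {i : ℕ} (hy : G.dist x y = i + 1) :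
    (distMatrix G (i + 2)).mulVec w y = 0 := by
  rw [distMatrix_mulVec]
  set F : X → ℂ := fun t => if G.dist y t = i + 2 then 1 else 0 with hF
  have hFw : ∀ t, (if G.dist y t = i + 2 then w t else 0) = F t * w t := fun t => by
    by_cases h : G.dist y t = i + 2 <;> simp [hF, h]
  simp only [hFw]
  have hconst : ∀ t u, G.dist x t = 1 → G.dist x u = 1 → G.dist t u = 1 → F t = F u := by
    have aux : ∀ t u, G.dist x t = 1 → G.dist x u = 1 → G.dist t u = 1 →
        G.dist y t = i + 2 → G.dist y u = i + 2 := by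
      intro t u ht hu htu hyt
      by_contra hne
      rw [SimpleGraph.dist_comm] at hyt hne
      have e1 := hG.1.dist_triangle (u := t) (v := u) (w := y)
      have e2 := hG.1.dist_triangle (u := u) (v := x) (w := y)
      rw [SimpleGraph.dist_comm (u := u) (v := x)] at e2
      -- Otherwise u is at distance i+1 from y, like x, and the triangle t, x, u with y is a kite of
      -- length i+2.
      exact no_kite hG hcl hD hb (x := t) (y := x) (t := u) (z := y)
        (by rw [SimpleGraph.dist_comm, ht]) hu htu hyt hy (by omega)
    intro t u ht hu htu
    have h1 := aux t u ht hu htu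
    have h2 := aux u t hu ht (by rw [SimpleGraph.dist_comm, htu])
    simp only [hF]
    by_cases h : G.dist y t = i + 2
    · rw [if_pos h, if_pos (h1 h)]
    · rw [if_neg h, if_neg fun h' => h (h2 h')]
  -- Double count over edges of Γ(x): summing first over u uses the eigenvalue -1, first over t the
  -- valency a_1.
  have key : ∑ t, F t * -w t = (aNum G 1 : ℂ) * ∑ t, F t * w t := by
    calc ∑ t, F t * -w t
        = ∑ t, ∑ u, if G.dist x t = 1 ∧ G.dist t u = 1 then F t * w u else 0 := by
          refine Finset.sum_congr rfl fun t _ => ?_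
          by_cases ht : G.dist x t = 1
          · rw [← hw.sum_adj t ht, Finset.mul_sum]
            refine Finset.sum_congr rfl fun u _ => ?_
            by_cases hu : G.dist t u = 1
            · rw [if_pos hu, if_pos ⟨ht, hu⟩]
            · rw [if_neg hu, if_neg fun h => hu h.2, mul_zero]
          · rw [hw.eq_zero t ht, neg_zero, mul_zero]
            exact (Finset.sum_eq_zero fun u _ => if_neg fun h => ht h.1).symm
      _ = ∑ u, ∑ t, if G.dist x t = 1 ∧ G.dist t u = 1 then F t * w u else 0 := Finset.sum_comm
      _ = ∑ u, (aNum G 1 : ℂ) * (F u * w u) := by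
          refine Finset.sum_congr rfl fun u _ => ?_
          by_cases hu : G.dist x u = 1
          · have hc := hG.card_aNum (by rw [hcl.1]; omega) x u
            rw [hu] at hc
            rw [← hc, Finset.card_filter, Nat.cast_sum, Finset.sum_mul]
            refine Finset.sum_congr rfl fun t _ => ?_
            by_cases ht : G.dist x t = 1 ∧ G.dist t u = 1
            · rw [if_pos ht, if_pos ht, hconst t u ht.1 hu ht.2, Nat.cast_one, one_mul]
            · rw [if_neg ht, if_neg ht, Nat.cast_zero, zero_mul]
          · simp [hw.eq_zero u hu]
      _ = (aNum G 1 : ℂ) * ∑ t, F t * w t := by rw [Finset.mul_sum]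
  simp only [mul_neg, Finset.sum_neg_distrib] at key
  have h1 : ((aNum G 1 + 1 : ℕ) : ℂ) * ∑ t, F t * w t = 0 := by
    push_cast
    linear_combination -key
  exact (mul_eq_zero.1 h1).resolve_left (Nat.cast_ne_zero.2 (Nat.succ_ne_zero _))

/-- The vectors `E*_i A_{i-1} w`, with value `0` for `i = 0`. -/
def ladder (G : SimpleGraph X) (x : X) (w : X → ℂ) : ℕ → X → ℂ
  | 0 => 0
  | i + 1 => (dualIdempotent G x (i + 1) * distMatrix G i).mulVec w

theorem ladder_succ_apply (x : X) (w : X → ℂ) (i : ℕ) (y : X) :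
    ladder G x w (i + 1) y =
      if G.dist x y = i + 1 then (distMatrix G i).mulVec w y else 0 := by
  rw [ladder, ← Matrix.mulVec_mulVec, dualIdempotent_mulVec]

theorem ladder_apply_of_ne (x : X) (w : X → ℂ) {i : ℕ} {y : X} (h : G.dist x y ≠ i) :
    ladder G x w i y = 0 := by
  cases i with
  | zero => rfl
  | succ i => rw [ladder_succ_apply, if_neg h]

theorem dualIdempotent_mulVec_ladder (x : X) (w : X → ℂ) (i j : ℕ) :
    (dualIdempotent G x i).mulVec (ladder G x w j) = if i = j then ladder G x w j else 0 := by
  ext y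
  rw [dualIdempotent_mulVec]
  by_cases h : i = j
  · subst h
    rw [if_pos rfl]
    by_cases h' : G.dist x y = i
    · rw [if_pos h']
    · rw [if_neg h', ladder_apply_of_ne x w h']
  · rw [if_neg h]
    by_cases h' : G.dist x y = i
    · rw [if_pos h', ladder_apply_of_ne x w (by omega), Pi.zero_apply]
    · rw [if_neg h', Pi.zero_apply]

theorem ladder_eq_zero_of_diam_lt (hG : IsDistanceRegular G) (x : X) (w : X → ℂ) {i : ℕ}
    (hi : G.diam < i) : ladder G x w i = 0 := by
  ext y
  have := hG.dist_le x y
  exact ladder_apply_of_ne x w (by omega)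

/-- At y in Γ_{i+1}(x) only j = i, i+1, i+2 can contribute, and `sum_far` removes i+2. As w sums to
zero, the other two values are opposite. At y = x everything vanishes, again by the zero sum. -/
theorem IsLocalVector.distMatrix_mulVec_eq (hG : IsDistanceRegular G)
    (hcl : HasClassicalParameters G D b α β) (hD : 3 ≤ D) (hb : b < -1) {x : X} {w : X → ℂ}
    (hw : IsLocalVector G x w) (j : ℕ) :
    (distMatrix G j).mulVec w = ladder G x w (j + 1) - ladder G x w j := by
  ext y
  rw [Pi.sub_apply]
  rcases h : G.dist x y with - | i
  · have hxy := hG.1.dist_eq_zero_iff.1 h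
    subst hxy
    have h0 : ladder G x w j x = 0 := by
      cases j with
      | zero => rfl
      | succ j => exact ladder_apply_of_ne x w (by omega)
    rw [ladder_apply_of_ne x w (by omega), h0, sub_zero, distMatrix_mulVec]
    by_cases hj : j = 1
    · subst hj
      refine (Finset.sum_congr rfl fun t _ => ?_).trans hw.sum_eq_zero
      by_cases ht : G.dist x t = 1
      · rw [if_pos ht]
      · rw [if_neg ht, hw.eq_zero t ht]
    · refine Finset.sum_eq_zero fun t _ => ?_
      by_cases ht : G.dist x t = j
      · rw [if_pos ht, hw.eq_zero t (by omega)]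
      · rw [if_neg ht]
  · have hcases : ∀ t, w t ≠ 0 → G.dist y t = i ∨ G.dist y t = i + 1 ∨ G.dist y t = i + 2 := by
      intro t ht
      have h1 : G.dist x t = 1 := by
        by_contra h1
        exact ht (hw.eq_zero t h1)
      have := hG.dist_cases h1 y
      rw [SimpleGraph.dist_comm (u := t)] at this
      omega
    have hzero : ∀ l, l ≠ i → l ≠ i + 1 → (distMatrix G l).mulVec w y = 0 := by
      intro l h1 h2
      by_cases h3 : l = i + 2
      · subst h3
        exact hw.sum_far hG hcl hD hb h
      · rw [distMatrix_mulVec]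
        refine Finset.sum_eq_zero fun t _ => ?_
        by_cases hl : G.dist y t = l
        · rw [if_pos hl]
          by_contra hne
          have := hcases t hne
          omega
        · rw [if_neg hl]
    have hneg : (distMatrix G (i + 1)).mulVec w y = -(distMatrix G i).mulVec w y := by
      have h1 := hw.sum_far hG hcl hD hb h
      have h2 := hw.sum_eq_zero
      rw [eq_neg_iff_add_eq_zero, ← h2]
      have h3 : (distMatrix G (i + 1)).mulVec w y + (distMatrix G i).mulVec w y +
          (distMatrix G (i + 2)).mulVec w y = ∑ t, w t := by
        simp only [distMatrix_mulVec, ← Finset.sum_add_distrib]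
        refine Finset.sum_congr rfl fun t _ => ?_
        by_cases ht : w t = 0
        · simp [ht]
        · rcases hcases t ht with e | e | e <;> simp [e]
      rw [← h3, h1, add_zero]
    by_cases h1 : j = i
    · subst h1
      rw [ladder_succ_apply, if_pos h, ladder_apply_of_ne x w (by omega), sub_zero]
    · rw [ladder_apply_of_ne x w (i := j + 1) (by omega), zero_sub]
      by_cases h2 : j = i + 1
      · subst h2
        rw [ladder_succ_apply, if_pos h, hneg]
      · rw [ladder_apply_of_ne x w (by omega), hzero j h1 h2, neg_zero]

/-- Induction on i: write the next ladder vector as A_{i+1} w plus the current one, and expand A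
A_{i+1} by the three-term recurrence. The value 0 of `ladder` at index 0 makes the formula hold at
the bottom. -/
theorem IsLocalVector.adj_mulVec_ladder (hG : IsDistanceRegular G)
    (hcl : HasClassicalParameters G D b α β) (hD : 3 ≤ D) (hb : b < -1) {x : X} {w : X → ℂ}
    (hw : IsLocalVector G x w) (i : ℕ) (hi : i + 1 ≤ D) :
    (distMatrix G 1).mulVec (ladder G x w (i + 1)) =
      ((bNum G 0 : ℂ) - cNum G (i + 1) - bNum G i) • ladder G x w (i + 1) +
        (bNum G i : ℂ) • ladder G x w i + (cNum G (i + 1) : ℂ) • ladder G x w (i + 2) := by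
  have hdiam : 1 ≤ G.diam := by rw [hcl.1]; omega
  have hstep := hw.distMatrix_mulVec_eq hG hcl hD hb
  induction i with
  | zero =>
    have h0 := hstep 0
    have hone : distMatrix G 0 = 1 := by
      rw [distMatrix_eq, Nat.cast_zero, distFun_single_zero hG]
    have hl0 : ladder G x w 0 = 0 := rfl
    rw [hone, Matrix.one_mulVec, hl0, sub_zero] at h0
    have hc1 : (cNum G 1 : ℂ) = 1 := by
      have := hcl.2.1 1 le_rfl (by omega)
      simp only [bracket, Finset.sum_range_succ, Finset.sum_range_zero, pow_zero, Nat.sub_self,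
        mul_zero, add_zero, zero_add, mul_one] at this
      exact_mod_cast this
    rw [zero_add, ← h0, hstep 1, hc1, ← h0, hl0]
    module
  | succ i ih =>
    have hprod : distMatrix G 1 * distMatrix G (i + 1) =
        (cNum G (i + 2) : ℂ) • distMatrix G (i + 2) + (aNum G (i + 1) : ℂ) • distMatrix G (i + 1) +
          (bNum G i : ℂ) • distMatrix G i := by
      simp only [distMatrix_eq]
      rw [← adj_mul_single hG hdiam, Nat.cast_one]
    have hsum : (cNum G (i + 1) + aNum G (i + 1) + bNum G (i + 1) : ℂ) = bNum G 0 := by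
      have := hG.add_num (h := i + 1) hdiam (by rw [hcl.1]; omega)
      exact_mod_cast this
    have e : ladder G x w (i + 1 + 1) =
        (distMatrix G (i + 1)).mulVec w + ladder G x w (i + 1) := by
      rw [hstep (i + 1)]; abel
    rw [e, Matrix.mulVec_add, ih (by omega), Matrix.mulVec_mulVec, hprod]
    simp only [Matrix.add_mulVec, Matrix.smul_mulVec, hstep, ← hsum]
    module

/-- Applying A and projecting back one level multiplies the previous ladder vector by some b_i ≠ 0,
so the first vanishing vector would force the one before it to vanish. -/
theorem IsLocalVector.ladder_ne_zero (hG : IsDistanceRegular G)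
    (hcl : HasClassicalParameters G D b α β) (hD : 3 ≤ D) (hb : b < -1) {x : X} {w : X → ℂ}
    (hw : IsLocalVector G x w) (hw0 : w ≠ 0) (i : ℕ) (hi : i + 1 ≤ D) :
    ladder G x w (i + 1) ≠ 0 := by
  induction i with
  | zero =>
    have h0 := hw.distMatrix_mulVec_eq hG hcl hD hb 0
    have hone : distMatrix G 0 = 1 := by
      rw [distMatrix_eq, Nat.cast_zero, distFun_single_zero hG]
    have hl0 : ladder G x w 0 = 0 := rfl
    rw [hone, Matrix.one_mulVec, hl0, sub_zero] at h0
    rwa [zero_add, ← h0]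
  | succ i ih =>
    intro h
    have h1 := hw.adj_mulVec_ladder hG hcl hD hb (i + 1) hi
    rw [h, Matrix.mulVec_zero] at h1
    have h2 := congrArg (dualIdempotent G x (i + 1)).mulVec h1
    simp only [Matrix.mulVec_zero, Matrix.mulVec_add, Matrix.mulVec_smul,
      dualIdempotent_mulVec_ladder, smul_zero, zero_add] at h2
    rw [if_pos trivial, if_neg (by omega), smul_zero, add_zero] at h2
    have hb' : (bNum G (i + 1) : ℂ) ≠ 0 :=
      Nat.cast_ne_zero.2 (hG.bNum_pos (by rw [hcl.1]; omega)).ne'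
    exact ih (by omega) ((smul_eq_zero.1 h2.symm).resolve_left hb')

end LocalVector

/-! ### Identifying the module W. -/

section Module

variable {X : Type*} [Fintype X] [DecidableEq X] {G : SimpleGraph X} {D : ℕ} {b α β : ℝ}

theorem distMatrix_mem_terwilligerAlgebra (x : X) {i : ℕ} (hi : i ≤ G.diam) :
    distMatrix G i ∈ terwilligerAlgebra G x :=
  Algebra.subset_adjoin (Or.inl (Submodule.subset_span ⟨i, hi, rfl⟩))

theorem dualIdempotent_mem_terwilligerAlgebra (x : X) {i : ℕ} (hi : i ≤ G.diam) :
    dualIdempotent G x i ∈ terwilligerAlgebra G x :=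
  Algebra.subset_adjoin (Or.inr (Submodule.subset_span ⟨i, hi, rfl⟩))

/-- The matrices that map the subspace `U` into itself. -/
def stabilizer (U : Submodule ℂ (X → ℂ)) : Subalgebra ℂ (Matrix X X ℂ) where
  carrier := {B | ∀ u ∈ U, B.mulVec u ∈ U}
  mul_mem' := fun {B B'} hB hB' u hu => by
    rw [← Matrix.mulVec_mulVec]
    exact hB _ (hB' u hu)
  add_mem' := fun {B B'} hB hB' u hu => by
    rw [Matrix.add_mulVec]
    exact U.add_mem (hB u hu) (hB' u hu)
  algebraMap_mem' := fun r u hu => by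
    rw [Algebra.algebraMap_eq_smul_one, Matrix.smul_mulVec, Matrix.one_mulVec]
    exact U.smul_mem r hu

/-- Every distance matrix is a polynomial in A, so A and the E*_i suffice. -/
theorem isTModule_of_stable (hG : IsDistanceRegular G) (hD : 1 ≤ G.diam) (x : X)
    (U : Submodule ℂ (X → ℂ)) (hA : ∀ u ∈ U, (distMatrix G 1).mulVec u ∈ U)
    (hE : ∀ i, ∀ u ∈ U, (dualIdempotent G x i).mulVec u ∈ U) : IsTModule G x U := by
  suffices h : terwilligerAlgebra G x ≤ stabilizer U from fun B hB u hu => h hB u hu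
  refine Algebra.adjoin_le (Set.union_subset ?_ ?_)
  · refine SetLike.coe_subset_coe.2 (?_ : boseMesner G ≤ (stabilizer U).toSubmodule)
    rw [boseMesner, Submodule.span_le]
    rintro _ ⟨i, -, rfl⟩
    rw [distMatrix_eq]
    refine distFun_single_mem hG hD (stabilizer U) ?_ i
    have : distMatrix G 1 ∈ stabilizer U := hA
    rwa [distMatrix_eq, Nat.cast_one] at this
  · refine SetLike.coe_subset_coe.2 (?_ : dualBoseMesner G x ≤ (stabilizer U).toSubmodule)
    rw [dualBoseMesner, Submodule.span_le]
    rintro _ ⟨i, -, rfl⟩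
    exact hE i

theorem IsTModule.ladder_mem (hG : IsDistanceRegular G) {x : X} {W : Submodule ℂ (X → ℂ)}
    (hW : IsTModule G x W) {w : X → ℂ} (hw : w ∈ W) (i : ℕ) : ladder G x w i ∈ W := by
  rcases Nat.lt_or_ge G.diam i with h | h
  · rw [ladder_eq_zero_of_diam_lt hG x w h]
    exact W.zero_mem
  · cases i with
    | zero => exact W.zero_mem
    | succ i =>
      exact hW _ (mul_mem (dualIdempotent_mem_terwilligerAlgebra x h)
        (distMatrix_mem_terwilligerAlgebra x (by omega))) _ hw

theorem dualComponent_le (x : X) {W : Submodule ℂ (X → ℂ)} (hW : IsTModule G x W) {i : ℕ}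
    (hi : i ≤ G.diam) : dualComponent G x i W ≤ W := by
  rintro _ ⟨u, hu, rfl⟩
  exact hW _ (dualIdempotent_mem_terwilligerAlgebra x hi) u hu

theorem dualComponent_eq_bot_of_lt_endpoint {x : X} {W : Submodule ℂ (X → ℂ)} {i : ℕ}
    (hi : i ≤ G.diam) (h : i < endpoint G x W) : dualComponent G x i W = ⊥ := by
  by_contra hne
  exact Nat.notMem_of_lt_sInf h ⟨hi, hne⟩

theorem isLocalVector_of_mem {x : X} {W : Submodule ℂ (X → ℂ)} (hD : 1 ≤ G.diam)
    (hW : IsTModule G x W) (hend : endpoint G x W = 1) (hloc : HasLocalEigenvalue G x W (-1))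
    {w : X → ℂ} (hw : w ∈ dualComponent G x 1 W) : IsLocalVector G x w := by
  have hsupp : ∀ t, G.dist x t ≠ 1 → w t = 0 := by
    obtain ⟨u, -, rfl⟩ := hw
    intro t ht
    rw [Matrix.mulVecLin_apply, dualIdempotent_mulVec, if_neg ht]
  have hE : (dualIdempotent G x 1).mulVec w = w := by
    ext t
    rw [dualIdempotent_mulVec]
    split_ifs with h
    · rfl
    · exact (hsupp t h).symm
  refine ⟨hsupp, ?_, fun t ht => ?_⟩
  -- The x-coordinate of A w is the sum of w over Γ(x), and it vanishes because E*_0 W = 0.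
  · have h1 : (dualIdempotent G x 0).mulVec ((distMatrix G 1).mulVec w) ∈
        dualComponent G x 0 W :=
      ⟨_, hW _ (distMatrix_mem_terwilligerAlgebra x hD) w (dualComponent_le x hW hD hw), rfl⟩
    rw [dualComponent_eq_bot_of_lt_endpoint (Nat.zero_le _) (by omega), Submodule.mem_bot] at h1
    have h2 := congrFun h1 x
    rw [dualIdempotent_mulVec, if_pos (by simp), distMatrix_mulVec, Pi.zero_apply] at h2
    rw [← h2]
    refine Finset.sum_congr rfl fun t _ => ?_
    split_ifs with h
    · rfl
    · exact hsupp t h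
  · have h1 := congrFun (hloc.2 w hw) t
    rw [← Matrix.mulVec_mulVec, ← Matrix.mulVec_mulVec, hE, dualIdempotent_mulVec, if_pos ht,
      distMatrix_mulVec] at h1
    rw [h1]
    simp

/-- By the tridiagonal action the span is a T-module inside W; it is nonzero, so irreducibility
gives equality. -/
theorem span_ladder_eq (hG : IsDistanceRegular G)
    (hcl : HasClassicalParameters G D b α β) (hD : 3 ≤ D) (hb : b < -1) {x : X}
    {W : Submodule ℂ (X → ℂ)} (hW : IsIrreducibleTModule G x W) {w : X → ℂ} (hwW : w ∈ W)
    (hw : IsLocalVector G x w) (hw0 : w ≠ 0) :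
    Submodule.span ℂ (Set.range fun i : Fin D => ladder G x w (i + 1)) = W := by
  set U := Submodule.span ℂ (Set.range fun i : Fin D => ladder G x w (i + 1)) with hU
  have hmem : ∀ i, ladder G x w i ∈ U := by
    intro i
    rcases Nat.lt_or_ge D i with h | h
    · rw [ladder_eq_zero_of_diam_lt hG x w (by rw [hcl.1]; exact h)]
      exact U.zero_mem
    · cases i with
      | zero => exact U.zero_mem
      | succ i => exact Submodule.subset_span ⟨⟨i, h⟩, rfl⟩
  have hstab : ∀ B : Matrix X X ℂ, (∀ i : Fin D, B.mulVec (ladder G x w (i + 1)) ∈ U) →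
      ∀ u ∈ U, B.mulVec u ∈ U := by
    intro B hB
    have : U ≤ U.comap B.mulVecLin := by
      rw [hU, Submodule.span_le]
      rintro _ ⟨i, rfl⟩
      exact hB i
    exact this
  have hUT : IsTModule G x U := by
    refine isTModule_of_stable hG (by rw [hcl.1]; omega) x U (hstab _ fun i => ?_)
      fun k => hstab _ fun i => ?_
    · rw [hw.adj_mulVec_ladder hG hcl hD hb i i.2]
      exact U.add_mem (U.add_mem (U.smul_mem _ (hmem _)) (U.smul_mem _ (hmem _)))
        (U.smul_mem _ (hmem _))
    · rw [dualIdempotent_mulVec_ladder]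
      split_ifs
      · exact hmem _
      · exact U.zero_mem
  refine (hW.2.2 U hUT ?_).resolve_left ?_
  · rw [hU, Submodule.span_le]
    rintro _ ⟨i, rfl⟩
    exact hW.1.ladder_mem hG hwW _
  · intro h
    have h1 := hmem 1
    rw [h, Submodule.mem_bot] at h1
    exact hw.ladder_ne_zero hG hcl hD hb hw0 0 (by omega) h1

/-- The vectors are nonzero with disjoint supports; each E*_i isolates one coefficient. -/
theorem linearIndependent_ladder (x : X) (w : X → ℂ)
    (h : ∀ i, i + 1 ≤ D → ladder G x w (i + 1) ≠ 0) :
    LinearIndependent ℂ fun i : Fin D => ladder G x w (i + 1) := by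
  rw [Fintype.linearIndependent_iff]
  intro g hg i
  have h1 := congrArg (dualIdempotent G x (i + 1)).mulVec hg
  rw [Matrix.mulVec_sum, Matrix.mulVec_zero, Finset.sum_eq_single i] at h1
  · rw [Matrix.mulVec_smul, dualIdempotent_mulVec_ladder, if_pos rfl] at h1
    exact (smul_eq_zero.1 h1).resolve_right (h i i.2)
  · intro k _ hk
    rw [Matrix.mulVec_smul, dualIdempotent_mulVec_ladder, if_neg, smul_zero]
    intro e
    exact hk (Fin.ext (by omega))
  · intro hi
    exact absurd (Finset.mem_univ i) hi

theorem dualComponent_eq_span (x : X) (w : X → ℂ) {W : Submodule ℂ (X → ℂ)}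
    (hspan : Submodule.span ℂ (Set.range fun i : Fin D => ladder G x w (i + 1)) = W) {i : ℕ}
    (hi : i + 1 ≤ D) :
    dualComponent G x (i + 1) W = Submodule.span ℂ {ladder G x w (i + 1)} := by
  rw [dualComponent, ← hspan, Submodule.map_span]
  refine le_antisymm (Submodule.span_le.2 ?_) (Submodule.span_le.2 ?_)
  · rintro _ ⟨_, ⟨k, rfl⟩, rfl⟩
    rw [Matrix.mulVecLin_apply, dualIdempotent_mulVec_ladder]
    split_ifs with h
    · rw [← h]
      exact Submodule.mem_span_singleton_self _
    · exact Submodule.zero_mem _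
  · rw [Set.singleton_subset_iff]
    refine Submodule.subset_span ⟨_, ⟨⟨i, hi⟩, rfl⟩, ?_⟩
    rw [Matrix.mulVecLin_apply, dualIdempotent_mulVec_ladder, if_pos rfl]

end Module

end DRG

end

theorem theorem10p2 {X : Type*} [Fintype X] [DecidableEq X] (G : SimpleGraph X)
    (hG : DRG.IsDistanceRegular G) (D : ℕ) (hD : 3 ≤ D) (b α β : ℝ)
    (hcl : DRG.HasClassicalParameters G D b α β) (hb : b < -1)
    (ha : DRG.aNum G 1 ≠ 0) (hnp : ¬ DRG.IsNearPolygon G) (x : X)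
    (W : Submodule ℂ (X → ℂ)) (hW : DRG.IsIrreducibleTModule G x W)
    (hend : DRG.endpoint G x W = 1) (hloc : DRG.HasLocalEigenvalue G x W (-1)) :
    (∀ w ∈ DRG.dualComponent G x 1 W, w ≠ 0 →
      ∃ B : Module.Basis (Fin D) ℂ W, ∀ i : Fin D,
        (B i : X → ℂ) =
          (DRG.dualIdempotent G x ((i : ℕ) + 1) * DRG.distMatrix G (i : ℕ)).mulVec w) ∧
    (∀ i : ℕ, 1 ≤ i → i ≤ D → Module.finrank ℂ (DRG.dualComponent G x i W) = 1) ∧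
    Module.finrank ℂ W = D ∧
    DRG.moduleDiameter G x W = D - 1 := by
  have hdiam : 1 ≤ G.diam := by rw [hcl.1]; omega
  have hlv : ∀ w ∈ DRG.dualComponent G x 1 W, DRG.IsLocalVector G x w := fun w hw =>
    DRG.isLocalVector_of_mem hdiam hW.1 hend hloc hw
  have hbasis : ∀ w ∈ DRG.dualComponent G x 1 W, w ≠ 0 →
      ∃ B : Module.Basis (Fin D) ℂ W, ∀ i : Fin D,
        (B i : X → ℂ) =
          (DRG.dualIdempotent G x ((i : ℕ) + 1) * DRG.distMatrix G (i : ℕ)).mulVec w := by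
    intro w hw hw0
    have hwW : w ∈ W := DRG.dualComponent_le x hW.1 hdiam hw
    have hspan := DRG.span_ladder_eq hG hcl hD hb hW hwW (hlv w hw) hw0
    have hli := DRG.linearIndependent_ladder (D := D) x w fun i hi =>
      (hlv w hw).ladder_ne_zero hG hcl hD hb hw0 i hi
    refine ⟨(Module.Basis.span hli).map (LinearEquiv.ofEq _ _ hspan), fun i => ?_⟩
    rw [Module.Basis.map_apply, LinearEquiv.coe_ofEq_apply, Module.Basis.span_apply]
    rfl
  obtain ⟨w, hw, hw0⟩ := Submodule.exists_mem_ne_zero_of_ne_bot hloc.1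
  have hwW : w ∈ W := DRG.dualComponent_le x hW.1 hdiam hw
  have hspan := DRG.span_ladder_eq hG hcl hD hb hW hwW (hlv w hw) hw0
  have hdim : ∀ i : ℕ, 1 ≤ i → i ≤ D →
      Module.finrank ℂ (DRG.dualComponent G x i W) = 1 := by
    intro i hi hiD
    obtain ⟨i, rfl⟩ : ∃ k, i = k + 1 := ⟨i - 1, by omega⟩
    rw [DRG.dualComponent_eq_span x w hspan hiD]
    exact finrank_span_singleton ((hlv w hw).ladder_ne_zero hG hcl hD hb hw0 i hiD)
  refine ⟨hbasis, hdim, ?_, ?_⟩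
  · obtain ⟨B, -⟩ := hbasis w hw hw0
    rw [Module.finrank_eq_card_basis B, Fintype.card_fin]
  · have hsupp : DRG.dualSupport G x W = Set.Icc 1 D := by
      ext i
      constructor
      · rintro ⟨h1, h2⟩
        refine ⟨?_, hcl.1 ▸ h1⟩
        by_contra h3
        exact h2 (DRG.dualComponent_eq_bot_of_lt_endpoint h1 (by omega))
      · rintro ⟨h1, h2⟩
        refine ⟨hcl.1 ▸ h2, fun h3 => ?_⟩
        have h4 := hdim i h1 h2
        rw [h3, finrank_bot] at h4
        exact zero_ne_one h4
    rw [DRG.moduleDiameter, hsupp, ← Finset.coe_Icc, Set.ncard_coe_finset, Nat.card_Icc]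
    omega
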